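/- Throughout, all objects are $C^\infty$-smooth. Let $M$ be a smooth manifold (Hausdorff, second countable, without boundary) of dimension $n\ge 1$, and let $T^0M=M$, $T^{r+1}M=T(T^rM)$, with canonical projections $\pi_r\colon T^{r+1}M\to T^rM$. For $r\ge 0$ let the slashed bundle $T^{r+1}M\setminus 0$ be the set of $\xi\in T^{r+1}M$ with $D(\pi_{T^rM\to M})(\xi)\neq 0$, so that $TM\setminus 0$ is the set of non-zero tangent vectors. For $r\ge 2$ let $\kappa_r\colon T^rM\to T^rM$ be the canonical involution, i.e. the diffeomorphism with $\partial_t\partial_s c=\kappa_r\circ\partial_s\partial_t c$ for all maps $c\colon(-\varepsilon,\varepsilon)^2\to T^{r-2}M$; in induced coordinates $\kappa_r(x,y,X,Y)=(x,X,y,Y)$. A spray on $M$ is a smooth vector field $S$ on $TM\setminus 0$ with $D\pi_0\circ S=\mathrm{id}$ and $[E,S]=S$, where $E$ is the Liouville vector field $E(x,y)=(x,y,0,y)$ on $TM$. The complete lifts of $S$ are the sprays $S^c=D\kappa_2\circ\kappa_3\circ DS\circ\kappa_2$ on $TM$ and $S^{cc}=D\kappa_3\circ\kappa_4\circ DS^c\circ\kappa_3$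 on $TTM$. A geodesic of a spray $A$ on $T^rM$ is a smooth curve $\gamma\colon I\to T^rM$ on an open interval $I$ such that $\gamma'(t)\in T^{r+1}M\setminus 0$ and $\gamma''(t)=A(\gamma'(t))$ for all $t\in I$. A parallel Jacobi field for $S$ is a curve $J\colon I\to TM$ of the form $J(t)=\alpha c'(t)+\beta t c'(t)$, where $c\colon I\to M$ is a geodesic of $S$ and $\alpha,\beta\in\mathbb R$. A set $\Delta\subset TTTM$ is a semi-distribution on $TTM$ of rank $k\ge 1$ if $\pi_2(\Delta)$ and $B=\pi_2(\kappa_3(\Delta))$ are (embedded) submanifolds of $TTM$, and every $b\in B$ has an open neighbourhood $U\subset B$ with smooth maps $V_1,\dots,V_k\colon U\to TTTM$ such that, for all $u\in U$: $\pi_2(V_i(u))=u$, the vectors $V_1(u),\dots,V_k(u)$ are linearly independent, and $\kappa_3(\Delta)\cap\pi_2^{-1}(u)=\operatorname{span}\{V_1(u),\dots,V_k(u)\}$ in the vector space $\pi_2^{-1}(u)$. A set $\Delta\subset TTTM$ is geodesically invariant for a spray $A$ on $TTM$ if for every geodesic $\gamma\colon I\to TTM$ of $A$ with $\gamma'(t_0)\in\Delta$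 for some $t_0\in I$ one has $\gamma'(t)\in\Delta$ for all $t\in I$. **Proposition.** Let $S$ be a spray on $M$, and let $$\Delta=\{(\kappa_2\circ J')'(0) : J\colon(-\varepsilon,\varepsilon)\to TM \text{ is a parallel Jacobi field for } S,\ \varepsilon>0\}\subset TTTM.$$ Then 1. $\Delta\subset TTTM\setminus 0$; 2. $\Delta$ is a semi-distribution on $TTM$ of rank $2$, and it is geodesically invariant for $S^{cc}$; 3. $\Delta$ (the phase space) is a submanifold of $TTTM$, and it is diffeomorphic to the submanifold $\pi_2(\Delta)$ (the configuration space) of $TTM$; both have dimension $2n+2$. -/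

import Mathlib

open Set Manifold
open scoped ContDiff

noncomputable section

namespace SprayGeometry

section Basic

variable {E : Type*} [NormedAddCommGroup E] [NormedSpace ℝ E]
  {H : Type*} [TopologicalSpace H] (I : ModelWithCorners ℝ E H)
  {N : Type*} [TopologicalSpace N] [ChartedSpace H N]
  {E' : Type*} [NormedAddCommGroup E'] [NormedSpace ℝ E']
  {H' : Type*} [TopologicalSpace H'] (I' : ModelWithCorners ℝ E' H')
  {N' : Type*} [TopologicalSpace N'] [ChartedSpace H' N']

/-- The tangent `γ'` of a curve `γ` in a manifold `N`, a curve in the tangent bundle `TN`. -/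
def velocity (γ : ℝ → N) (t : ℝ) : TangentBundle I N :=
  ⟨γ t, mfderiv 𝓘(ℝ, ℝ) I γ t (1 : ℝ)⟩

/-- `B` is an embedded submanifold of dimension `d` of the smooth manifold `N` (of finite dimension
and without boundary): around each point of `B` there is a smooth chart of `N` in which `B` is a
`d`-dimensional linear slice. -/
def IsSubmanifold (d : ℕ) (B : Set N) : Prop :=
  ∀ p ∈ B, ∃ φ ∈ IsManifold.maximalAtlas I ∞ N, p ∈ φ.source ∧
    ∃ L : Submodule ℝ E, Module.finrank ℝ L = d ∧ ∀ q ∈ φ.source, q ∈ B ↔ I (φ q) ∈ L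

/-- The subsets `A` and `B` of two manifolds are diffeomorphic: there are mutually inverse
bijections that are smooth. On an embedded submanifold, `ContMDiffOn` (smoothness with respect to
the ambient manifold, along the subset) is smoothness for the submanifold structure. -/
def AreDiffeomorphic (A : Set N) (B : Set N') : Prop :=
  ∃ (f : N → N') (g : N' → N), ContMDiffOn I I' ∞ f A ∧ ContMDiffOn I' I ∞ g B ∧
    MapsTo f A B ∧ MapsTo g B A ∧ LeftInvOn g f A ∧ RightInvOn g f B

end Basic

section SecondTangent

variable {E : Type*} [NormedAddCommGroup E] [NormedSpace ℝ E]
  {H : Type*} [TopologicalSpace H] (I : ModelWithCorners ℝ E H)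
  (N : Type*) [TopologicalSpace N] [ChartedSpace H N] [IsManifold I ∞ N]

/-- The second tangent bundle `TTN`. -/
abbrev TT : Type _ := TangentBundle I.tangent (TangentBundle I N)

/-- The third tangent bundle `TTTN`. -/
abbrev TTT : Type _ := TangentBundle I.tangent.tangent (TT I N)

variable {N}

/-- The canonical involution `κ : TTN → TTN`, which in induced coordinates is
`(x, y, X, Y) ↦ (x, X, y, Y)`. In Mathlib, the fibre coordinates of a point of `TTN` above `x : N`
are its coordinates in the chart of `TTN` that is induced by the preferred chart at `x`, and this
chart depends on `x` only.
For `N = T^(r-2)M` this is the canonical involution `κ_r` of `T^rM`. -/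
def canonicalInvolution (ξ : TT I N) : TT I N :=
  ⟨⟨ξ.1.1, Prod.fst (α := E) (β := E) ξ.2⟩,
    Prod.mk (α := E) (β := E) ξ.1.2 (Prod.snd (α := E) (β := E) ξ.2)⟩

/-- The Liouville vector field on `TN`, in induced coordinates `(x, y) ↦ (x, y, 0, y)`. -/
def liouville (ξ : TangentBundle I N) : TangentSpace I.tangent ξ :=
  Prod.mk (α := E) (β := E) 0 ξ.2

/-- The complete lift `S^c = Dκ ∘ κ ∘ DS ∘ κ` of a map `S : TN → TTN`, in particular of a spray
on `N`. It is a map `TTN → TTTN`. -/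
def completeLift (S : TangentBundle I N → TT I N) : TT I N → TTT I N :=
  fun ξ ↦ tangentMap I.tangent.tangent I.tangent.tangent (canonicalInvolution I (N := N))
    (canonicalInvolution I.tangent (N := TangentBundle I N)
      (tangentMap I.tangent I.tangent.tangent S (canonicalInvolution I ξ)))

/-- A set `Δ ⊆ TTN` is a semi-distribution of rank `k` on the manifold `TN`. (With
`N = T^(r-1)M`, this is a semi-distribution on `T^rM` for `r ≥ 1`.) Here `Δ` is moved by the
involution `κ` of `TTN`, and linear structures are those of the fibres of `TTN → TN`. -/
def IsSemiDistribution (k : ℕ) (Δ : Set (TT I N)) : Prop :=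
  1 ≤ k ∧
  (∃ d, IsSubmanifold I.tangent d (Bundle.TotalSpace.proj '' Δ)) ∧
  (∃ d, IsSubmanifold I.tangent d (Bundle.TotalSpace.proj '' (canonicalInvolution I '' Δ))) ∧
  ∀ b ∈ Bundle.TotalSpace.proj '' (canonicalInvolution I '' Δ),
    ∃ U : Set (TangentBundle I N), b ∈ U ∧
      (∃ W : Set (TangentBundle I N), IsOpen W ∧
        U = Bundle.TotalSpace.proj '' (canonicalInvolution I '' Δ) ∩ W) ∧
      ∃ V : Fin k → ∀ u : TangentBundle I N, TangentSpace I.tangent u,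
        (∀ i, ContMDiffOn I.tangent I.tangent.tangent ∞ (fun u ↦ (⟨u, V i u⟩ : TT I N)) U) ∧
        ∀ u ∈ U, LinearIndependent ℝ (fun i ↦ V i u) ∧
          {w : TangentSpace I.tangent u | (⟨u, w⟩ : TT I N) ∈ canonicalInvolution I '' Δ} =
            (Submodule.span ℝ (range fun i ↦ V i u) : Set (TangentSpace I.tangent u))

end SecondTangent

/-! The defining property `∂_t ∂_s c = κ ∘ ∂_s ∂_t c` of the canonical involution. -/

section InvolutionProperty

open Bundle Filter

variable {E : Type*} [NormedAddCommGroup E] [NormedSpace ℝ E]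
  {H : Type*} [TopologicalSpace H] (I : ModelWithCorners ℝ E H)
  {N : Type*} [TopologicalSpace N] [ChartedSpace H N]

theorem velocity_eq {γ : ℝ → N} {t : ℝ} (hγ : MDifferentiableAt 𝓘(ℝ, ℝ) I γ t) {x : N}
    (hx : γ t = x) :
    velocity I γ t = ⟨x, (fderiv ℝ (extChartAt I x ∘ γ) t 1 : E)⟩ := by
  subst hx
  have : mfderiv 𝓘(ℝ, ℝ) I γ t = fderiv ℝ (extChartAt I (γ t) ∘ γ) t := by
    rw [hγ.mfderiv]
    change fderivWithin ℝ _ (range id) _ = _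
    rw [range_id, fderivWithin_univ]
    rfl
  simp only [velocity]
  rw [this]
  rfl

variable [IsManifold I ∞ N]

theorem trivializationAt_velocity {γ : ℝ → N} {t : ℝ}
    (hγ : MDifferentiableAt 𝓘(ℝ, ℝ) I γ t) (x : N) (hx : γ t ∈ (chartAt H x).source) :
    (trivializationAt E (TangentSpace I) x (velocity I γ t)).2
      = fderiv ℝ (extChartAt I x ∘ γ) t 1 := by
  have h := TangentBundle.continuousLinearMapAt_trivializationAt (I := I) hx
  have h2 : (trivializationAt E (TangentSpace I) x (velocity I γ t)).2 =
      (trivializationAt E (TangentSpace I) x).continuousLinearMapAt ℝ (γ t)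
        (mfderiv 𝓘(ℝ, ℝ) I γ t (1 : ℝ)) := by
    rw [Trivialization.continuousLinearMapAt_apply, Trivialization.linearMapAt_apply, if_pos]
    · rfl
    · simpa using hx
  rw [h2, h, ← mfderiv_eq_fderiv, mfderiv_comp t (mdifferentiableAt_extChartAt hx) hγ]
  rfl

theorem velocity_velocity {c : ℝ × ℝ → N} {p : ℝ × ℝ}
    (hc : ContMDiffAt 𝓘(ℝ, ℝ × ℝ) I ∞ c p) (t₀ s₀ : ℝ) (u v : ℝ × ℝ) :
    velocity I.tangent
      (fun t : ℝ ↦ velocity I (fun s : ℝ ↦ c (p + (t - t₀) • u + (s - s₀) • v)) s₀) t₀ =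
    (⟨⟨c p, (fderiv ℝ (extChartAt I (c p) ∘ c) p v : E)⟩,
      ((fderiv ℝ (extChartAt I (c p) ∘ c) p u : E),
        (fderiv ℝ (fderiv ℝ (extChartAt I (c p) ∘ c)) p u v : E))⟩ : TT I N) := by
  set f := extChartAt I (c p) ∘ c with hf
  have hfs : ContDiffAt ℝ ∞ f p := by
    rw [← contMDiffAt_iff_contDiffAt]
    exact (contMDiffAt_extChartAt (n := ∞) (I := I) (x := c p)).comp p hc
  have hev1 : ∀ᶠ q in nhds p, MDifferentiableAt 𝓘(ℝ, ℝ × ℝ) I c q := by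
    have h1 : ContMDiffAt 𝓘(ℝ, ℝ × ℝ) I 1 c p := hc.of_le (by norm_cast)
    have := (contMDiffAt_iff_contMDiffAt_nhds (n := 1) (by simp)).1 h1
    filter_upwards [this] with q hq using hq.mdifferentiableAt (by norm_num)
  have hev2 : ∀ᶠ q in nhds p, c q ∈ (chartAt H (c p)).source :=
    hc.continuousAt.eventually ((chartAt H (c p)).open_source.mem_nhds (mem_chart_source H (c p)))
  have hev3 : ∀ᶠ q in nhds p, DifferentiableAt ℝ f q := by
    have := (hfs.of_le (m := 1) (by norm_cast)).eventually (by simp)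
    filter_upwards [this] with q hq using hq.differentiableAt (by norm_num)
  have hline : ∀ (q w : ℝ × ℝ) (a s : ℝ), HasDerivAt (fun s : ℝ ↦ q + (s - a) • w) w s :=
    fun q w a s ↦ by
      simpa using (((hasDerivAt_id s).sub_const a).smul_const w).const_add q
  have hfline : ∀ (q w : ℝ × ℝ) (a : ℝ), DifferentiableAt ℝ f q →
      fderiv ℝ (f ∘ fun s : ℝ ↦ q + (s - a) • w) a 1 = fderiv ℝ f q w := by
    intro q w a h
    have h5 : HasDerivAt (f ∘ fun s : ℝ ↦ q + (s - a) • w) (fderiv ℝ f q w) a :=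
      HasFDerivAt.comp_hasDerivAt a (by simpa using h.hasFDerivAt) (hline q w a a)
    exact h5.deriv
  have key : ∀ (q w : ℝ × ℝ) (a : ℝ), MDifferentiableAt 𝓘(ℝ, ℝ × ℝ) I c q →
      MDifferentiableAt 𝓘(ℝ, ℝ) I (fun s : ℝ ↦ c (q + (s - a) • w)) a := by
    intro q w a h1
    have hq : q + (a - a) • w = q := by simp
    refine MDifferentiableAt.comp (I' := 𝓘(ℝ, ℝ × ℝ)) (g := c)
      (f := fun s : ℝ ↦ q + (s - a) • w) a ?_ ?_
    · rw [hq]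
      exact h1
    · exact (hline q w a a).differentiableAt.mdifferentiableAt
  have htend : Tendsto (fun t : ℝ ↦ p + (t - t₀) • u) (nhds t₀) (nhds p) := by
    have := (hline p u t₀ t₀).continuousAt.tendsto
    simpa using this
  set Γ : ℝ → TangentBundle I N :=
    fun t ↦ velocity I (fun s : ℝ ↦ c (p + (t - t₀) • u + (s - s₀) • v)) s₀ with hΓ
  have hp0 : p + (t₀ - t₀) • u = p := by simp
  have hbase : Γ t₀ = ⟨c p, (fderiv ℝ f p v : E)⟩ := by
    have e : Γ t₀ = velocity I (fun s : ℝ ↦ c (p + (s - s₀) • v)) s₀ := by simp [hΓ]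
    rw [e, velocity_eq I (key p v s₀ hev1.self_of_nhds) (x := c p) (by simp),
      ← hfline p v s₀ hev3.self_of_nhds]
    rfl
  have htriv : (fun t ↦ (trivializationAt E (TangentSpace I) (c p) (Γ t)).2) =ᶠ[nhds t₀]
      fun t ↦ fderiv ℝ f (p + (t - t₀) • u) v := by
    filter_upwards [htend.eventually hev1, htend.eventually hev2, htend.eventually hev3]
      with t h1 h2 h3
    simp only [hΓ]
    rw [trivializationAt_velocity I (key _ v s₀ h1) _ (by simpa using h2), ← hfline _ v s₀ h3]
    rfl
  have hff : DifferentiableAt ℝ (fderiv ℝ f) p :=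
    (hfs.fderiv_right (m := 1) (by norm_cast)).differentiableAt (by norm_num)
  have hd2 : HasDerivAt (fun t : ℝ ↦ fderiv ℝ f (p + (t - t₀) • u) v)
      (fderiv ℝ (fderiv ℝ f) p u v) t₀ := by
    have h6 : HasDerivAt ((fderiv ℝ f) ∘ fun t : ℝ ↦ p + (t - t₀) • u)
        (fderiv ℝ (fderiv ℝ f) p u) t₀ :=
      HasFDerivAt.comp_hasDerivAt t₀ (by rw [hp0]; exact hff.hasFDerivAt) (hline p u t₀ t₀)
    simpa using h6.clm_apply (hasDerivAt_const t₀ v)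
  have hprojΓ : (fun t ↦ (Γ t).proj) = fun t ↦ c (p + (t - t₀) • u) := by
    funext t
    simp [hΓ, velocity]
  have hmd : MDifferentiableAt 𝓘(ℝ, ℝ) I.tangent Γ t₀ := by
    refine (mdifferentiableAt_totalSpace (IB := I) (F := E) (E := TangentSpace I) Γ).2 ⟨?_, ?_⟩
    · rw [hprojΓ]
      exact key p u t₀ hev1.self_of_nhds
    · have hpr : (Γ t₀).proj = c p := by rw [hbase]
      rw [hpr]
      exact (htriv.differentiableAt_iff.2 hd2.differentiableAt).mdifferentiableAt
  rw [velocity_eq I.tangent hmd hbase]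
  have hcomp : (extChartAt I.tangent (⟨c p, (fderiv ℝ f p v : E)⟩ : TangentBundle I N)) ∘ Γ =
      fun t ↦ ((f ∘ fun t : ℝ ↦ p + (t - t₀) • u) t,
        (trivializationAt E (TangentSpace I) (c p) (Γ t)).2) := by
    funext t
    have := congrFun hprojΓ t
    refine Prod.ext ?_ rfl
    change extChartAt I (c p) (Γ t).proj = extChartAt I (c p) (c (p + (t - t₀) • u))
    rw [this]
  have h7 : HasDerivAt (f ∘ fun s : ℝ ↦ p + (s - t₀) • u) (fderiv ℝ f p u) t₀ :=
    HasFDerivAt.comp_hasDerivAt t₀ (by simpa using hev3.self_of_nhds.hasFDerivAt)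
      (hline p u t₀ t₀)
  have h8 := h7.prodMk (hd2.congr_of_eventuallyEq htriv)
  rw [hcomp]
  congr 1
  exact h8.deriv

/-- The defining property of the canonical involution: `∂_t ∂_s c = κ (∂_s ∂_t c)`. -/
theorem canonicalInvolution_velocity {c : ℝ × ℝ → N} {t₀ s₀ : ℝ}
    (hc : ContMDiffAt 𝓘(ℝ, ℝ × ℝ) I ∞ c (t₀, s₀)) :
    velocity I.tangent (fun t ↦ velocity I (fun s ↦ c (t, s)) s₀) t₀ =
      canonicalInvolution I
        (velocity I.tangent (fun s ↦ velocity I (fun t ↦ c (t, s)) t₀) s₀) := by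
  have hfs : ContDiffAt ℝ ∞ (extChartAt I (c (t₀, s₀)) ∘ c) (t₀, s₀) := by
    rw [← contMDiffAt_iff_contDiffAt]
    exact (contMDiffAt_extChartAt (n := ∞) (I := I) (x := c (t₀, s₀))).comp (t₀, s₀) hc
  have h1 := velocity_velocity I hc t₀ s₀ (1, 0) (0, 1)
  have h2 := velocity_velocity I hc s₀ t₀ (0, 1) (1, 0)
  simp only [Prod.smul_mk, Prod.mk_add_mk, smul_eq_mul, mul_one, mul_zero, add_zero,
    add_sub_cancel] at h1 h2
  rw [h1, h2, (hfs.isSymmSndFDerivAt (by simp; norm_cast)) (1, 0) (0, 1)]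
  rfl

end InvolutionProperty

section Sprays

variable {E : Type*} [NormedAddCommGroup E] [NormedSpace ℝ E]
  {H : Type*} [TopologicalSpace H] (I : ModelWithCorners ℝ E H)
  {M : Type*} [TopologicalSpace M] [ChartedSpace H M] [IsManifold I ∞ M]
  {F : Type*} [NormedAddCommGroup F] [NormedSpace ℝ F]
  {G : Type*} [TopologicalSpace G] (J : ModelWithCorners ℝ F G)
  {N : Type*} [TopologicalSpace N] [ChartedSpace G N] [IsManifold J ∞ N]

/-- For the projection `p : N → M` of an iterated tangent bundle `N = T^rM` of `M`, this is the
slashed tangent bundle `T^(r+1)M∖0` of all `ξ ∈ TN` with `Dp(ξ) ≠ 0`. For `p = id` it is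
`TM∖0`. -/
def slashed (p : N → M) : Set (TangentBundle J N) :=
  {ξ | (tangentMap J I p ξ).2 ≠ 0}

/-- `γ` is a geodesic, on the open interval `K`, of the spray `S` on the iterated tangent bundle
`N = T^rM` with projection `p : N → M`: it is smooth, regular (`γ'(t)` lies in the slashed bundle),
and satisfies `γ'' = S ∘ γ'`. -/
def IsGeodesicOn (p : N → M) (S : TangentBundle J N → TT J N) (γ : ℝ → N) (K : Set ℝ) : Prop :=
  ContMDiffOn 𝓘(ℝ, ℝ) J ∞ γ K ∧
  ∀ t ∈ K, velocity J γ t ∈ slashed I J p ∧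
    velocity J.tangent (velocity J γ) t = S (velocity J γ t)

/-- `Δ ⊆ TN` is geodesically invariant for `S`: a geodesic whose tangent lies in `Δ` at one time
has its tangent in `Δ` at all times. -/
def IsGeodesicallyInvariant (p : N → M) (S : TangentBundle J N → TT J N)
    (Δ : Set (TangentBundle J N)) : Prop :=
  ∀ (γ : ℝ → N) (K : Set ℝ), IsOpen K → K.OrdConnected → IsGeodesicOn I J p S γ K →
    ∀ t₀ ∈ K, velocity J γ t₀ ∈ Δ → ∀ t ∈ K, velocity J γ t ∈ Δ

/-- The map `TM → TTM` given by a vector field on `TM`. -/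
def fieldMap (S : ∀ y : TangentBundle I M, TangentSpace I.tangent y) :
    TangentBundle I M → TT I M :=
  fun y ↦ ⟨y, S y⟩

/-- A vector field `S` on `TM∖0` (values on the zero section are irrelevant), as a section of the
tangent bundle of `TM`, is a spray on `M`: it is smooth, `Dπ ∘ S = id`, and `[E, S] = S` for the
Liouville vector field `E`. -/
structure IsSpray (S : ∀ y : TangentBundle I M, TangentSpace I.tangent y) : Prop where
  smooth : ContMDiffOn I.tangent I.tangent.tangent ∞ (fieldMap I S)
    (slashed I I (id : M → M))
  projection : ∀ y ∈ slashed I I (id : M → M),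
    tangentMap I.tangent I (Bundle.TotalSpace.proj : TangentBundle I M → M)
      (fieldMap I S y) = y
  homogeneous : ∀ y ∈ slashed I I (id : M → M),
    VectorField.mlieBracket I.tangent (liouville I) S y = S y

/-- `Y` is a parallel Jacobi field for the spray `S` on the interval `K`:
`Y(t) = α c'(t) + β t c'(t)` for a geodesic `c : K → M` and reals `α`, `β`. -/
def IsParallelJacobiOn (S : ∀ y : TangentBundle I M, TangentSpace I.tangent y)
    (Y : ℝ → TangentBundle I M) (K : Set ℝ) : Prop :=
  ∃ (α β : ℝ) (c : ℝ → M), IsGeodesicOn I I id (fieldMap I S) c K ∧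
    ∀ t ∈ K, Y t = ⟨c t, α • (velocity I c t).2 + (β * t) • (velocity I c t).2⟩

/-- The set `Δ ⊆ TTTM` of all `(κ₂ ∘ Y')'(0)` for parallel Jacobi fields `Y : (-ε, ε) → TM`. -/
def parallelJacobiSet (S : ∀ y : TangentBundle I M, TangentSpace I.tangent y) :
    Set (TTT I M) :=
  {ξ | ∃ (ε : ℝ) (Y : ℝ → TangentBundle I M), 0 < ε ∧ IsParallelJacobiOn I S Y (Ioo (-ε) ε) ∧
    ξ = velocity I.tangent.tangent (fun t ↦ canonicalInvolution I (velocity I.tangent Y t)) 0}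

/-- The second complete lift `S^cc` of a spray `S` on `M`, a spray on `TTM`. -/
def secondCompleteLift (S : ∀ y : TangentBundle I M, TangentSpace I.tangent y) :
    TTT I M → TT I.tangent.tangent (TT I M) :=
  completeLift I.tangent (completeLift I (fieldMap I S))

variable (M) in
/-- The projection `TTM → M`. -/
def projTT (ξ : TT I M) : M := ξ.1.1

end Sprays

end SprayGeometry

end

open SprayGeometry

/-! Write Σ for `sprayLiouvilleSpan`, the set of all αS(y) + βE(y) with y in TM∖0, and L = κ₃ ∘ DS
for the `linearization` of S. Over vectors based in TM∖0, L is a smooth section of TTTM → TTM.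
Everything rests on the identity Δ = L(Σ), which is `parallelJacobiSet_eq`.

For J = a c' with a = α + βt, induced coordinates give κ₂ ∘ J' = a S(c') + β E(c'). If y' = S(y) and
a' = β, then the curve Z = a S(y) + β E(y) satisfies Z' = L(Z): in a chart the two sides differ by
β(S − [E,S]), which vanishes by homogeneity (`velocity_smul_add_smul`). At t = 0 this gives Δ ⊆
L(Σ). The converse holds because every y in TM∖0 is tangent to a geodesic.

The static claims follow. The vector L(q) projects to the nonzero vector q.1 of TM, so Δ is slashed.
Since Δ is the image of Σ under a section, π₂ and L are mutually inverse diffeomorphisms between Δ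
and Σ, and Σ is parametrised by (y, α, β), which gives dimension 2n + 2. Moreover κ₃(Δ) = DS(Σ) lies
over S(TM∖0), and its fibres are the images of span{S, E} under the injective maps DS, so they have
dimension 2.

Invariance rests on DL ∘ L = S^cc ∘ L (`tangentMap_linearization_eq_secondCompleteLift`): a solution
of Z' = L(Z) yields the solution L ∘ Z of the field S^cc. The tangent of a given geodesic of S^cc
projects to an integral curve y of S on the whole interval. The curve Z built from y with the
coefficients at t₀ therefore lives on the whole interval, and uniqueness of integral curves
identifies γ' with L ∘ Z. -/

namespace SprayGeometry

set_option linter.unusedSectionVars false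

open Bundle Filter Topology

/-! ### Tangent maps and velocities of curves. -/

section TangentMaps

variable {E : Type*} [NormedAddCommGroup E] [NormedSpace ℝ E]
  {H : Type*} [TopologicalSpace H] {I : ModelWithCorners ℝ E H}
  {N : Type*} [TopologicalSpace N] [ChartedSpace H N]
  {E' : Type*} [NormedAddCommGroup E'] [NormedSpace ℝ E']
  {H' : Type*} [TopologicalSpace H'] {I' : ModelWithCorners ℝ E' H'}
  {N' : Type*} [TopologicalSpace N'] [ChartedSpace H' N']
  {E'' : Type*} [NormedAddCommGroup E''] [NormedSpace ℝ E'']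
  {H'' : Type*} [TopologicalSpace H''] {I'' : ModelWithCorners ℝ E'' H''}
  {N'' : Type*} [TopologicalSpace N''] [ChartedSpace H'' N'']

theorem tangentMap_velocity {f : N → N'} {γ : ℝ → N} {t : ℝ}
    (hf : MDifferentiableAt I I' f (γ t)) (hγ : MDifferentiableAt 𝓘(ℝ, ℝ) I γ t) :
    tangentMap I I' f (velocity I γ t) = velocity I' (f ∘ γ) t := by
  simp only [velocity, tangentMap]
  rw [mfderiv_comp t hf hγ]
  rfl

theorem velocity_congr {γ γ' : ℝ → N} {t : ℝ} (h : γ =ᶠ[𝓝 t] γ') :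
    velocity I γ t = velocity I γ' t := by
  simp only [velocity]
  rw [h.mfderiv_eq, h.eq_of_nhds]

theorem tangentMap_congr {f g : N → N'} {ξ : TangentBundle I N} (h : f =ᶠ[𝓝 ξ.1] g) :
    tangentMap I I' f ξ = tangentMap I I' g ξ := by
  simp only [tangentMap]
  rw [h.mfderiv_eq, h.eq_of_nhds]

theorem tangentMap_comp_apply {g : N' → N''} {f : N → N'} (ξ : TangentBundle I N)
    (hg : MDifferentiableAt I' I'' g (f ξ.1)) (hf : MDifferentiableAt I I' f ξ.1) :
    tangentMap I I'' (g ∘ f) ξ = tangentMap I' I'' g (tangentMap I I' f ξ) := by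
  simp only [tangentMap]
  rw [mfderiv_comp ξ.1 hg hf]
  rfl

variable [IsManifold I ∞ N] [IsManifold I' ∞ N']

theorem contMDiffOn_tangentMap {f : N → N'} {s : Set N} (hs : IsOpen s)
    (hf : ContMDiffOn I I' ∞ f s) :
    ContMDiffOn I.tangent I'.tangent ∞ (tangentMap I I' f)
      (TotalSpace.proj ⁻¹' s : Set (TangentBundle I N)) := by
  refine (hf.contMDiffOn_tangentMapWithin (m := ∞) (by simp) hs.uniqueMDiffOn).congr fun ξ hξ ↦ ?_
  simp only [tangentMap, tangentMapWithin]
  rw [mfderivWithin_of_isOpen hs hξ]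

theorem contMDiff_tangentMap {f : N → N'} (hf : ContMDiff I I' ∞ f) :
    ContMDiff I.tangent I'.tangent ∞ (tangentMap I I' f) :=
  hf.contMDiff_tangentMap (m := ∞) (by simp)

/-- The velocity is the tangent map of γ applied to the constant unit field on ℝ. -/
theorem contMDiffOn_velocity {γ : ℝ → N} {K : Set ℝ} (hK : IsOpen K)
    (hγ : ContMDiffOn 𝓘(ℝ, ℝ) I ∞ γ K) :
    ContMDiffOn 𝓘(ℝ, ℝ) I.tangent ∞ (velocity I γ) K := by
  have h1 : ContMDiff 𝓘(ℝ, ℝ) 𝓘(ℝ, ℝ).tangent ∞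
      (fun t : ℝ ↦ (⟨t, (1 : ℝ)⟩ : TangentBundle 𝓘(ℝ, ℝ) ℝ)) :=
    contMDiff_vectorSpace_iff_contDiff.2 contDiff_const
  exact (contMDiffOn_tangentMap hK hγ).comp h1.contMDiffOn fun t ht ↦ ht

theorem contMDiff_tangent_proj :
    ContMDiff I.tangent I ∞ (TotalSpace.proj : TangentBundle I N → N) :=
  contMDiff_proj (TangentSpace I)

/-- Between the preferred charts the projection is literally the first projection of E × E, so its
derivative is too. -/
theorem tangentMap_proj (ξ : TT I N) :
    tangentMap I.tangent I (TotalSpace.proj : TangentBundle I N → N) ξ =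
      ⟨ξ.1.1, Prod.fst (α := E) (β := E) ξ.2⟩ := by
  have h : HasMFDerivAt I.tangent I (TotalSpace.proj : TangentBundle I N → N) ξ.1
      (ContinuousLinearMap.fst ℝ E E) := by
    refine ⟨(FiberBundle.continuous_proj E (TangentSpace I)).continuousAt, ?_⟩
    have hx : extChartAt I.tangent ξ.1 ξ.1 ∈ (extChartAt I.tangent ξ.1).target :=
      mem_extChartAt_target ξ.1
    have h2 : ∀ z ∈ (extChartAt I.tangent ξ.1).target,
        writtenInExtChartAt I.tangent I ξ.1 (TotalSpace.proj : TangentBundle I N → N) z =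
          ContinuousLinearMap.fst ℝ E E z :=
      fun z hz ↦ congrArg Prod.fst ((extChartAt I.tangent ξ.1).right_inv hz)
    refine HasFDerivWithinAt.congr_of_eventuallyEq
      (ContinuousLinearMap.fst ℝ E E).hasFDerivWithinAt ?_ (h2 _ hx)
    filter_upwards [extChartAt_target_mem_nhdsWithin (I := I.tangent) ξ.1] with z hz
    exact h2 z hz
  simp only [tangentMap]
  rw [h.mfderiv]
  rfl

end TangentMaps

/-! ### Naturality of the canonical involution. -/

section Involution

variable {E : Type*} [NormedAddCommGroup E] [NormedSpace ℝ E]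
  {H : Type*} [TopologicalSpace H] {I : ModelWithCorners ℝ E H}
  {N : Type*} [TopologicalSpace N] [ChartedSpace H N] [IsManifold I ∞ N]
  {E' : Type*} [NormedAddCommGroup E'] [NormedSpace ℝ E']
  {H' : Type*} [TopologicalSpace H'] {I' : ModelWithCorners ℝ E' H'}
  {N' : Type*} [TopologicalSpace N'] [ChartedSpace H' N'] [IsManifold I' ∞ N']

theorem canonicalInvolution_canonicalInvolution (ξ : TT I N) :
    canonicalInvolution I (canonicalInvolution I ξ) = ξ := rfl

/-- The involution exchanges the two projections π and Dπ of TTN onto TN. This turns statements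
about the base point of κ(ξ) into statements about Dπ, which is chart free and visibly smooth. -/
theorem proj_canonicalInvolution (ξ : TT I N) :
    (canonicalInvolution I ξ).1 = tangentMap I.tangent I TotalSpace.proj ξ :=
  (tangentMap_proj ξ).symm

theorem tangentMap_proj_canonicalInvolution (ξ : TT I N) :
    tangentMap I.tangent I TotalSpace.proj (canonicalInvolution I ξ) = ξ.1 := by
  rw [← proj_canonicalInvolution, canonicalInvolution_canonicalInvolution]

/-- Every element of TTN is a mixed second velocity of a two-parameter map, so identities in TTN can
be checked by interchanging derivatives. -/
theorem exists_velocity_velocity_eq_mk [I.Boundaryless] (x : N) (y X Y : E) :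
    ∃ (c : ℝ × ℝ → N) (O : Set (ℝ × ℝ)), IsOpen O ∧ ((0 : ℝ), (0 : ℝ)) ∈ O ∧
      ContMDiffOn 𝓘(ℝ, ℝ × ℝ) I ∞ c O ∧ c (0, 0) = x ∧
      (⟨⟨x, y⟩, (X, Y)⟩ : TT I N) =
        velocity I.tangent (fun s ↦ velocity I (fun t ↦ c (t, s)) 0) 0 := by
  -- With p = (t, s), at the origin ∂_t P = y, ∂_s P = X and ∂_s ∂_t P = Y.
  set P : ℝ × ℝ → E := fun p ↦ extChartAt I x x + p.2 • X + p.1 • y + (p.1 * p.2) • Y with hP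
  have hPs : ContDiff ℝ ∞ P := by fun_prop
  have hP0 : P (0, 0) = extChartAt I x x := by simp [hP]
  have hO : IsOpen (P ⁻¹' (extChartAt I x).target) :=
    (isOpen_extChartAt_target x).preimage hPs.continuous
  have h0 : ((0 : ℝ), (0 : ℝ)) ∈ P ⁻¹' (extChartAt I x).target := by
    rw [mem_preimage, hP0]
    exact mem_extChartAt_target x
  have hc : ContMDiffOn 𝓘(ℝ, ℝ × ℝ) I ∞ ((extChartAt I x).symm ∘ P)
      (P ⁻¹' (extChartAt I x).target) :=
    (contMDiffOn_extChartAt_symm x).comp hPs.contMDiff.contMDiffOn fun p hp ↦ hp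
  have hc0 : ((extChartAt I x).symm ∘ P) (0, 0) = x := by
    simp only [Function.comp_apply, hP0]
    exact extChartAt_to_inv x
  refine ⟨_, _, hO, h0, hc, hc0, ?_⟩
  set c := (extChartAt I x).symm ∘ P with hcdef
  have key := velocity_velocity I (hc.contMDiffAt (hO.mem_nhds h0)) 0 0 (0, 1) (1, 0)
  simp only [Prod.smul_mk, Prod.mk_add_mk, smul_eq_mul, mul_one, mul_zero, add_zero, zero_add,
    sub_zero] at key
  rw [key, hc0]
  have hev : extChartAt I x ∘ c =ᶠ[𝓝 (0, 0)] P := by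
    filter_upwards [hO.mem_nhds h0] with p hp
    exact (extChartAt I x).right_inv hp
  have hd : ∀ p : ℝ × ℝ, HasFDerivAt P ((ContinuousLinearMap.snd ℝ ℝ ℝ).smulRight X +
      (ContinuousLinearMap.fst ℝ ℝ ℝ).smulRight y +
      (p.1 • ContinuousLinearMap.snd ℝ ℝ ℝ + p.2 • ContinuousLinearMap.fst ℝ ℝ ℝ).smulRight Y) p := by
    intro p
    exact ((((ContinuousLinearMap.snd ℝ ℝ ℝ).hasFDerivAt.smul_const X).const_add _).add
      ((ContinuousLinearMap.fst ℝ ℝ ℝ).hasFDerivAt.smul_const y)).add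
      (((ContinuousLinearMap.fst ℝ ℝ ℝ).hasFDerivAt.mul
        (ContinuousLinearMap.snd ℝ ℝ ℝ).hasFDerivAt).smul_const Y)
  have hd2 : HasFDerivAt (fun p : ℝ × ℝ ↦ fderiv ℝ P p (1, 0)) 
      ((ContinuousLinearMap.snd ℝ ℝ ℝ).smulRight Y) (0, 0) := by
    have : (fun p : ℝ × ℝ ↦ fderiv ℝ P p (1, 0)) = fun p ↦ y + p.2 • Y := by
      funext p
      rw [(hd p).fderiv]
      simp
    rw [this]
    exact ((ContinuousLinearMap.snd ℝ ℝ ℝ).hasFDerivAt.smul_const Y).const_add _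
  have hdd : fderiv ℝ (fderiv ℝ P) (0, 0) (0, 1) (1, 0) = Y := by
    have h3 : DifferentiableAt ℝ (fderiv ℝ P) (0, 0) :=
      (hPs.fderiv_right (m := 1) (by norm_cast)).differentiable (by norm_num) _
    have h4 := (h3.hasFDerivAt.clm_apply (hasFDerivAt_const ((1 : ℝ), (0 : ℝ)) (0, 0))).unique hd2
    have h5 := congrArg (fun L ↦ L ((0 : ℝ), (1 : ℝ))) h4
    simpa using h5
  have e1 : fderiv ℝ P (0, 0) (1, 0) = y := by simp [(hd (0, 0)).fderiv]
  have e2 : fderiv ℝ P (0, 0) (0, 1) = X := by simp [(hd (0, 0)).fderiv]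
  rw [hev.fderiv_eq, hev.fderiv.fderiv_eq, hdd, e1, e2]

theorem exists_velocity_velocity_eq [I.Boundaryless] (ξ : TT I N) :
    ∃ (c : ℝ × ℝ → N) (O : Set (ℝ × ℝ)), IsOpen O ∧ ((0 : ℝ), (0 : ℝ)) ∈ O ∧
      ContMDiffOn 𝓘(ℝ, ℝ × ℝ) I ∞ c O ∧ c (0, 0) = ξ.1.1 ∧
      ξ = velocity I.tangent (fun s ↦ velocity I (fun t ↦ c (t, s)) 0) 0 :=
  exists_velocity_velocity_eq_mk (E := E) (I := I) (N := N) ξ.1.1 ξ.1.2 (Prod.fst (α := E) (β := E) ξ.2)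
    (Prod.snd (α := E) (β := E) ξ.2)

/-- On ξ = ∂_s ∂_t c the map DDf gives ∂_s ∂_t (f ∘ c), and on both manifolds κ just exchanges the
order of the two derivatives. -/
theorem canonicalInvolution_tangentMap [I.Boundaryless] {f : N → N'} {s : Set N} (hs : IsOpen s)
    (hf : ContMDiffOn I I' ∞ f s) (ξ : TT I N) (hξ : ξ.1.1 ∈ s) :
    canonicalInvolution I' (tangentMap I.tangent I'.tangent (tangentMap I I' f) ξ) =
      tangentMap I.tangent I'.tangent (tangentMap I I' f) (canonicalInvolution I ξ) := by
  obtain ⟨c, O, hO, h0, hc, hc0, hξc⟩ := exists_velocity_velocity_eq ξ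
  have hcont := hc.continuousOn
  obtain ⟨O', hO', h0', hc', hm⟩ : ∃ O' : Set (ℝ × ℝ), IsOpen O' ∧ ((0 : ℝ), (0 : ℝ)) ∈ O' ∧
      ContMDiffOn 𝓘(ℝ, ℝ × ℝ) I ∞ c O' ∧ MapsTo c O' s := by
    refine ⟨O ∩ c ⁻¹' s, hcont.isOpen_inter_preimage hO hs, ⟨h0, ?_⟩,
      hc.mono inter_subset_left, fun p hp ↦ hp.2⟩
    rw [mem_preimage, hc0]
    exact hξ
  -- Stated for an arbitrary map because it is needed both for c and for c with its two parameters
  -- swapped.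
  have aux : ∀ c : ℝ × ℝ → N, ∀ O' : Set (ℝ × ℝ), IsOpen O' → ((0 : ℝ), (0 : ℝ)) ∈ O' →
      ContMDiffOn 𝓘(ℝ, ℝ × ℝ) I ∞ c O' → MapsTo c O' s →
      tangentMap I.tangent I'.tangent (tangentMap I I' f)
        (velocity I.tangent (fun s ↦ velocity I (fun t ↦ c (t, s)) 0) 0) =
      velocity I'.tangent (fun s ↦ velocity I' (fun t ↦ (f ∘ c) (t, s)) 0) 0 := by
    intro c O' hO' h0' hc' hm
    set U : Set ℝ := (fun s : ℝ ↦ ((0 : ℝ), s)) ⁻¹' O' with hU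
    have hUo : IsOpen U := hO'.preimage (by fun_prop)
    have hU0 : (0 : ℝ) ∈ U := h0'
    -- The curve s ↦ ∂_t c(0, s) is smooth because it is Dc applied to the constant field (1, 0)
    -- along the s-axis.
    have hΓ : ContMDiffOn 𝓘(ℝ, ℝ) I.tangent ∞ (fun s ↦ velocity I (fun t ↦ c (t, s)) 0) U := by
      have h1 := contMDiffOn_tangentMap hO' hc'
      have h2 : ContMDiff 𝓘(ℝ, ℝ) 𝓘(ℝ, ℝ × ℝ).tangent ∞
          (fun s : ℝ ↦ (⟨((0 : ℝ), s), ((1 : ℝ), (0 : ℝ))⟩ : TangentBundle 𝓘(ℝ, ℝ × ℝ) (ℝ × ℝ))) := by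
        have h3 : ContMDiff 𝓘(ℝ, ℝ × ℝ) 𝓘(ℝ, ℝ × ℝ).tangent ∞
          (fun p : ℝ × ℝ ↦ (⟨p, ((1 : ℝ), (0 : ℝ))⟩ : TangentBundle 𝓘(ℝ, ℝ × ℝ) (ℝ × ℝ))) :=
          contMDiff_vectorSpace_iff_contDiff.2 contDiff_const
        have h4 : ContMDiff 𝓘(ℝ, ℝ) 𝓘(ℝ, ℝ × ℝ) ∞ (fun s : ℝ ↦ ((0 : ℝ), s)) :=
          (by fun_prop : ContDiff ℝ ∞ (fun s : ℝ ↦ ((0 : ℝ), s))).contMDiff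
        exact h3.comp h4
      refine (h1.comp h2.contMDiffOn fun t ht ↦ ht).congr fun t ht ↦ ?_
      have h5 : MDifferentiableAt 𝓘(ℝ, ℝ × ℝ) I c (0, t) :=
        (hc'.contMDiffAt (hO'.mem_nhds ht)).mdifferentiableAt (by simp)
      have h6 : HasFDerivAt (fun r : ℝ ↦ (r, t)) (ContinuousLinearMap.inl ℝ ℝ ℝ) 0 :=
        hasFDerivAt_prodMk_left 0 t
      have h7 := mfderiv_comp (I' := 𝓘(ℝ, ℝ × ℝ)) (0 : ℝ) (g := c) (f := fun r : ℝ ↦ (r, t)) h5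
        h6.differentiableAt.mdifferentiableAt
      have h8 : velocity I (fun r ↦ c (r, t)) 0 =
          ⟨c (0, t), mfderiv 𝓘(ℝ, ℝ) I (c ∘ fun r : ℝ ↦ (r, t)) 0 (1 : ℝ)⟩ := rfl
      rw [h8, h7, mfderiv_eq_fderiv, h6.fderiv]
      rfl
    have hmd := (hΓ.contMDiffAt (hUo.mem_nhds hU0)).mdifferentiableAt (by simp)
    have hslice : ∀ t ∈ U, MDifferentiableAt 𝓘(ℝ, ℝ) I (fun r ↦ c (r, t)) 0 := by
      intro t ht
      exact MDifferentiableAt.comp (I' := 𝓘(ℝ, ℝ × ℝ)) (g := c) (f := fun r : ℝ ↦ (r, t)) 0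
        ((hc'.contMDiffAt (hO'.mem_nhds ht)).mdifferentiableAt (by simp))
        (hasFDerivAt_prodMk_left 0 t).differentiableAt.mdifferentiableAt
    rw [tangentMap_velocity _ hmd]
    · apply velocity_congr
      filter_upwards [hUo.mem_nhds hU0] with t ht
      refine tangentMap_velocity (γ := fun r ↦ c (r, t)) ?_ (hslice t ht)
      exact (hf.contMDiffAt (hs.mem_nhds (hm ht))).mdifferentiableAt (by simp)
    · exact ((contMDiffOn_tangentMap hs hf).contMDiffAt
        ((hs.preimage (FiberBundle.continuous_proj E (TangentSpace I))).mem_nhds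
          (hm h0'))).mdifferentiableAt (by simp)
  have hsw : ContDiff ℝ ∞ (Prod.swap : ℝ × ℝ → ℝ × ℝ) := contDiff_snd.prodMk contDiff_fst
  have hcs : ContMDiffOn 𝓘(ℝ, ℝ × ℝ) I ∞ (c ∘ Prod.swap) (Prod.swap ⁻¹' O') :=
    hc'.comp hsw.contMDiff.contMDiffOn fun p hp ↦ hp
  have hfc : ContMDiffAt 𝓘(ℝ, ℝ × ℝ) I' ∞ (f ∘ c) ((0 : ℝ), (0 : ℝ)) :=
    ((hf.comp hc' hm).contMDiffAt (hO'.mem_nhds h0'))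
  have e1 := aux c O' hO' h0' hc' hm
  have e2 := aux (c ∘ Prod.swap) _ (hO'.preimage continuous_swap) h0' hcs fun p hp ↦ hm hp
  have e3 := canonicalInvolution_velocity I (hc'.contMDiffAt (hO'.mem_nhds h0'))
  have e4 := canonicalInvolution_velocity I' hfc
  rw [hξc, e1, ← e4, ← e3]
  exact e2.symm

end Involution

/-! ### Smoothness of the canonical involution. -/

section InvolutionSmooth

variable {E : Type*} [NormedAddCommGroup E] [NormedSpace ℝ E]
  {H : Type*} [TopologicalSpace H] {I : ModelWithCorners ℝ E H}
  {N : Type*} [TopologicalSpace N] [ChartedSpace H N] [IsManifold I ∞ N]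
  {E' : Type*} [NormedAddCommGroup E'] [NormedSpace ℝ E']
  {H' : Type*} [TopologicalSpace H'] {I' : ModelWithCorners ℝ E' H'}
  {N' : Type*} [TopologicalSpace N'] [ChartedSpace H' N'] [IsManifold I' ∞ N']

theorem isOpen_proj_preimage {s : Set N} (hs : IsOpen s) :
    IsOpen (TotalSpace.proj ⁻¹' s : Set (TangentBundle I N)) :=
  hs.preimage (FiberBundle.continuous_proj E (TangentSpace I))

/-- Over a vector space all points have the same preferred chart, so the coordinate change is that
of a chart with itself. -/
theorem trivializationAt_tangent_modelSpace (p : TangentBundle 𝓘(ℝ, E) E) (ξ : TT 𝓘(ℝ, E) E) :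
    (trivializationAt (E × E) (TangentSpace 𝓘(ℝ, E).tangent) p ξ).2 = ξ.2 :=
  (tangentBundleCore 𝓘(ℝ, E).tangent (TangentBundle 𝓘(ℝ, E) E)).coordChange_self
    (achart (ModelProd E E) ξ.1) ξ.1 (mem_achart_source _ _) ξ.2

theorem contMDiff_canonicalInvolution_modelSpace :
    ContMDiff 𝓘(ℝ, E).tangent.tangent 𝓘(ℝ, E).tangent.tangent ∞
      (canonicalInvolution 𝓘(ℝ, E) (N := E)) := by
  intro ξ₀
  rw [contMDiffAt_totalSpace]
  constructor
  · exact ((contMDiff_tangentMap (contMDiff_tangent_proj (I := 𝓘(ℝ, E)) (N := E))).congr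
      fun ξ ↦ proj_canonicalInvolution ξ) ξ₀
  · simp_rw [trivializationAt_tangent_modelSpace]
    have h1 : ContMDiff 𝓘(ℝ, E).tangent.tangent 𝓘(ℝ, E) ∞
        (fun ξ : TT 𝓘(ℝ, E) E ↦ (ξ.1.2 : E)) :=
      (contMDiff_snd_tangentBundle_modelSpace E 𝓘(ℝ, E)).comp
        (contMDiff_tangent_proj (I := 𝓘(ℝ, E).tangent) (N := TangentBundle 𝓘(ℝ, E) E))
    have h2 := (contMDiffAt_totalSpace.1 (contMDiffAt_id (n := ∞)
      (I := 𝓘(ℝ, E).tangent.tangent) (x := ξ₀))).2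
    simp_rw [id, trivializationAt_tangent_modelSpace] at h2
    have h3 : ContMDiffAt 𝓘(ℝ, E).tangent.tangent 𝓘(ℝ, E) ∞
        (fun ξ : TT 𝓘(ℝ, E) E ↦ Prod.snd (α := E) (β := E) ξ.2) ξ₀ :=
      (contDiff_snd (𝕜 := ℝ) (E := E) (F := E)).contMDiff.contMDiffAt.comp ξ₀ h2
    exact (h1 ξ₀).prodMk_space h3

theorem tangentMap_of_eventuallyEq_id {f : N → N} {ξ : TangentBundle I N}
    (h : f =ᶠ[𝓝 ξ.1] id) : tangentMap I I f ξ = ξ := by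
  rw [tangentMap_congr h, tangentMap_id]
  rfl

theorem tangentMap_leftInverse {f : N → N'} {g : N' → N} {s : Set N} {t : Set N'} (hs : IsOpen s)
    (ht : IsOpen t) (hf : ContMDiffOn I I' ∞ f s) (hg : ContMDiffOn I' I ∞ g t)
    (hst : MapsTo f s t) (hgf : LeftInvOn g f s) :
    LeftInvOn (tangentMap I' I g) (tangentMap I I' f) (TotalSpace.proj ⁻¹' s) := by
  intro ξ hξ
  rw [← tangentMap_comp_apply ξ
    ((hg.contMDiffAt (ht.mem_nhds (hst hξ))).mdifferentiableAt (by simp))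
    ((hf.contMDiffAt (hs.mem_nhds hξ)).mdifferentiableAt (by simp))]
  apply tangentMap_of_eventuallyEq_id
  filter_upwards [hs.mem_nhds hξ] with x hx using hgf hx

/-- The definition of κ uses a preferred chart that varies with the point, so smoothness is not
visible from it. Naturality under a fixed chart φ gives κ = DDφ⁻¹ ∘ κ_E ∘ DDφ near ξ₀, where κ_E is
the smooth involution over the model space. -/
theorem contMDiff_canonicalInvolution [I.Boundaryless] :
    ContMDiff I.tangent.tangent I.tangent.tangent ∞ (canonicalInvolution I (N := N)) := by
  intro ξ₀
  set x := ξ₀.1.1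
  set s := (extChartAt I x).source with hsdef
  set t := (extChartAt I x).target with htdef
  have hs : IsOpen s := isOpen_extChartAt_source x
  have ht : IsOpen t := isOpen_extChartAt_target x
  have hf : ContMDiffOn I 𝓘(ℝ, E) ∞ (extChartAt I x) s := by
    rw [hsdef, extChartAt_source]
    exact contMDiffOn_extChartAt
  have hg : ContMDiffOn 𝓘(ℝ, E) I ∞ (extChartAt I x).symm t := contMDiffOn_extChartAt_symm x
  have hst : MapsTo (extChartAt I x) s t := (extChartAt I x).mapsTo
  have hgf : LeftInvOn (extChartAt I x).symm (extChartAt I x) s := (extChartAt I x).leftInvOn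
  have hs1 : IsOpen (TotalSpace.proj ⁻¹' s : Set (TangentBundle I N)) := isOpen_proj_preimage hs
  have ht1 : IsOpen (TotalSpace.proj ⁻¹' t : Set (TangentBundle 𝓘(ℝ, E) E)) :=
    isOpen_proj_preimage ht
  have hs2 : IsOpen (TotalSpace.proj ⁻¹' (TotalSpace.proj ⁻¹' s) : Set (TT I N)) :=
    isOpen_proj_preimage hs1
  have hTf := contMDiffOn_tangentMap hs hf
  have hTg := contMDiffOn_tangentMap ht hg
  have hTTf := contMDiffOn_tangentMap hs1 hTf
  have hTTg := contMDiffOn_tangentMap ht1 hTg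
  have hinv := tangentMap_leftInverse hs1 ht1 hTf hTg (fun ξ hξ ↦ hst hξ)
    (tangentMap_leftInverse hs ht hf hg hst hgf)
  have hcomp := hTTg.comp (contMDiff_canonicalInvolution_modelSpace.comp_contMDiffOn hTTf)
    fun ξ hξ ↦ hst hξ
  refine ContMDiffOn.contMDiffAt (hcomp.congr fun ξ hξ ↦ ?_)
    (hs2.mem_nhds (mem_extChartAt_source (I := I) x))
  simp only [Function.comp_apply]
  rw [canonicalInvolution_tangentMap hs hf ξ hξ]
  exact (hinv (x := canonicalInvolution I ξ) hξ).symm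

end InvolutionSmooth

/-! ### Linearisations and complete lifts. -/

section CompleteLift

variable {E : Type*} [NormedAddCommGroup E] [NormedSpace ℝ E]
  {H : Type*} [TopologicalSpace H] {I : ModelWithCorners ℝ E H} [I.Boundaryless]
  {N : Type*} [TopologicalSpace N] [ChartedSpace H N] [IsManifold I ∞ N]

theorem mdifferentiableAt_canonicalInvolution (ξ : TT I N) :
    MDifferentiableAt I.tangent.tangent I.tangent.tangent (canonicalInvolution I (N := N)) ξ :=
  (contMDiff_canonicalInvolution ξ).mdifferentiableAt (by simp)

theorem mdifferentiableAt_tangent_proj (ξ : TangentBundle I N) :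
    MDifferentiableAt I.tangent I (TotalSpace.proj : TangentBundle I N → N) ξ :=
  (contMDiff_tangent_proj ξ).mdifferentiableAt (by simp)

theorem mdifferentiableAt_tangentMap_proj (ξ : TT I N) :
    MDifferentiableAt I.tangent.tangent I.tangent
      (tangentMap I.tangent I (TotalSpace.proj : TangentBundle I N → N)) ξ :=
  (contMDiff_tangentMap contMDiff_tangent_proj ξ).mdifferentiableAt (by simp)

/-- The linearised field `κ ∘ DS` of a map `S : N → TN`. -/
noncomputable def linearization (S : N → TangentBundle I N) : TangentBundle I N → TT I N :=
  fun ξ ↦ canonicalInvolution I (tangentMap I I.tangent S ξ)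

theorem completeLift_eq (S : TangentBundle I N → TT I N) (ξ : TT I N) :
    completeLift I S ξ = tangentMap I.tangent.tangent I.tangent.tangent (canonicalInvolution I)
      (linearization S (canonicalInvolution I ξ)) := rfl

theorem contMDiffOn_linearization {S : N → TangentBundle I N} {s : Set N} (hs : IsOpen s)
    (hS : ContMDiffOn I I.tangent ∞ S s) :
    ContMDiffOn I.tangent I.tangent.tangent ∞ (linearization S) (TotalSpace.proj ⁻¹' s) :=
  contMDiff_canonicalInvolution.comp_contMDiffOn (contMDiffOn_tangentMap hs hS)

theorem contMDiffOn_completeLift {S : TangentBundle I N → TT I N} {s : Set (TangentBundle I N)}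
    (hs : IsOpen s) (hS : ContMDiffOn I.tangent I.tangent.tangent ∞ S s) :
    ContMDiffOn I.tangent.tangent I.tangent.tangent.tangent ∞ (completeLift I S)
      (tangentMap I.tangent I TotalSpace.proj ⁻¹' s) := by
  refine (contMDiff_tangentMap contMDiff_canonicalInvolution).comp_contMDiffOn
    ((contMDiffOn_linearization hs hS).comp contMDiff_canonicalInvolution.contMDiffOn ?_)
  intro ξ hξ
  change (canonicalInvolution I ξ).1 ∈ s
  rwa [proj_canonicalInvolution]

/-- `D(Dπ) ∘ S^c = S ∘ Dπ`. -/
theorem tangentMap_tangentMap_proj_completeLift (S : TangentBundle I N → TT I N) (ξ : TT I N) :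
    tangentMap I.tangent.tangent I.tangent (tangentMap I.tangent I TotalSpace.proj)
      (completeLift I S ξ) = S (tangentMap I.tangent I TotalSpace.proj ξ) := by
  rw [completeLift_eq, ← tangentMap_comp_apply _ (mdifferentiableAt_tangentMap_proj _)
    (mdifferentiableAt_canonicalInvolution _)]
  -- Since Dπ ∘ κ = π, the outer Dκ of the complete lift is absorbed: D(Dπ) ∘ Dκ = Dπ.
  have : tangentMap I.tangent I TotalSpace.proj ∘ canonicalInvolution I (N := N) =
      TotalSpace.proj := by
    funext ξ
    exact tangentMap_proj_canonicalInvolution ξ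
  rw [this, linearization, tangentMap_proj_canonicalInvolution, ← proj_canonicalInvolution]
  rfl

/-- If `S` is a section over `s`, its linearisation is a section over the preimage of `s`. -/
theorem proj_linearization {S : N → TangentBundle I N} {s : Set N} (hs : IsOpen s)
    (hS : ContMDiffOn I I.tangent ∞ S s) (hsec : ∀ x ∈ s, (S x).1 = x) (ξ : TangentBundle I N)
    (hξ : ξ.1 ∈ s) : (linearization S ξ).1 = ξ := by
  rw [linearization, proj_canonicalInvolution, ← tangentMap_comp_apply ξ
    (mdifferentiableAt_tangent_proj _)
    ((hS.contMDiffAt (hs.mem_nhds hξ)).mdifferentiableAt (by simp))]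
  apply tangentMap_of_eventuallyEq_id
  filter_upwards [hs.mem_nhds hξ] with x hx using hsec x hx

theorem proj_completeLift {S : TangentBundle I N → TT I N} {s : Set (TangentBundle I N)}
    (hs : IsOpen s) (hS : ContMDiffOn I.tangent I.tangent.tangent ∞ S s)
    (hsec : ∀ x ∈ s, (S x).1 = x) (ξ : TT I N)
    (hξ : tangentMap I.tangent I TotalSpace.proj ξ ∈ s) : (completeLift I S ξ).1 = ξ := by
  rw [← proj_canonicalInvolution] at hξ
  change canonicalInvolution I (linearization S (canonicalInvolution I ξ)).1 = ξ
  rw [proj_linearization hs hS hsec _ hξ, canonicalInvolution_canonicalInvolution]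

end CompleteLift

/-! ### The Lie bracket and the linearised equation in a chart. -/

section LieDerivative

variable {E : Type*} [NormedAddCommGroup E] [NormedSpace ℝ E]
  {H : Type*} [TopologicalSpace H] {I : ModelWithCorners ℝ E H} [I.Boundaryless]
  {N : Type*} [TopologicalSpace N] [ChartedSpace H N] [IsManifold I ∞ N]

variable (I) in
/-- The representative of the vector field `V` in the preferred chart at `p`. -/
noncomputable def localRep (V : ∀ x : N, TangentSpace I x) (p : N) (z : E) : E :=
  (trivializationAt E (TangentSpace I) p
    ⟨(extChartAt I p).symm z, V ((extChartAt I p).symm z)⟩).2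

theorem trivializationAt_snd_eq_mfderiv (p : N) (ξ : TangentBundle I N)
    (hξ : ξ.1 ∈ (chartAt H p).source) :
    (trivializationAt E (TangentSpace I) p ξ).2 =
      mfderiv I 𝓘(ℝ, E) (extChartAt I p) ξ.1 ξ.2 := by
  have h : (trivializationAt E (TangentSpace I) p ξ).2 =
      (trivializationAt E (TangentSpace I) p).continuousLinearMapAt ℝ ξ.1 ξ.2 := by
    rw [Trivialization.continuousLinearMapAt_apply, Trivialization.linearMapAt_apply, if_pos]
    simpa using hξ
  rw [h, TangentBundle.continuousLinearMapAt_trivializationAt hξ]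
  rfl

theorem mk_tangent_injective {p : N} {v w : E}
    (h : (⟨p, v⟩ : TangentBundle I N) = ⟨p, w⟩) : v = w :=
  eq_of_heq (TotalSpace.mk.inj h).2

theorem trivializationAt_smul_add_smul {p q : N} (hq : q ∈ (chartAt H p).source)
    (a b : ℝ) (v w : TangentSpace I q) :
    (trivializationAt E (TangentSpace I) p (⟨q, a • v + b • w⟩ : TangentBundle I N)).2 =
      a • (trivializationAt E (TangentSpace I) p (⟨q, v⟩ : TangentBundle I N)).2 +
        b • (trivializationAt E (TangentSpace I) p (⟨q, w⟩ : TangentBundle I N)).2 := by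
  have hl := (trivializationAt E (TangentSpace I) p).linear ℝ
    (show q ∈ (trivializationAt E (TangentSpace I) p).baseSet from hq)
  rw [hl.map_add, hl.map_smul, hl.map_smul]

theorem trivializationAt_self (p : N) (v : TangentSpace I p) :
    (trivializationAt E (TangentSpace I) p (⟨p, v⟩ : TangentBundle I N)).2 = v :=
  (tangentBundleCore I N).coordChange_self (achart H p) p (mem_achart_source H p) v

theorem localRep_self (V : ∀ x : N, TangentSpace I x) (p : N) :
    localRep I V p (extChartAt I p p) = V p := by
  simp only [localRep]
  rw [extChartAt_to_inv]
  exact trivializationAt_self p (V p)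

/-- Pulling back along the inverse chart inverts the derivative of that map. The inverse is the
derivative of the chart, which is the trivialisation used in `localRep`. -/
theorem mpullbackWithin_extChartAt_symm_eq_localRep (V : ∀ x : N, TangentSpace I x) (p : N) {z : E}
    (hz : z ∈ (extChartAt I p).target) :
    VectorField.mpullbackWithin 𝓘(ℝ, E) I (extChartAt I p).symm V (range I) z =
      localRep I V p z := by
  have hsrc : (extChartAt I p).symm z ∈ (extChartAt I p).source := (extChartAt I p).map_target hz
  have hsrc' : (extChartAt I p).symm z ∈ (chartAt H p).source := by
    rwa [extChartAt_source] at hsrc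
  rw [VectorField.mpullbackWithin_apply, localRep, trivializationAt_snd_eq_mfderiv p _ hsrc']
  have h1 := mfderiv_extChartAt_comp_mfderivWithin_extChartAt_symm hz
  have h2 := mfderivWithin_extChartAt_symm_comp_mfderiv_extChartAt hz
  rw [ContinuousLinearMap.inverse_eq h2 h1]
  rfl

theorem trivializationAt_smul {p q : N} (hq : q ∈ (chartAt H p).source)
    (a : ℝ) (v : TangentSpace I q) :
    (trivializationAt E (TangentSpace I) p (⟨q, a • v⟩ : TangentBundle I N)).2 =
      a • (trivializationAt E (TangentSpace I) p (⟨q, v⟩ : TangentBundle I N)).2 :=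
  ((trivializationAt E (TangentSpace I) p).linear ℝ
    (show q ∈ (trivializationAt E (TangentSpace I) p).baseSet from hq)).map_smul a v

theorem lieBracketWithin_univ_eq_of_eventuallyEq {V W V' W' : E → E} {x : E} (hV : V =ᶠ[𝓝 x] V')
    (hW : W =ᶠ[𝓝 x] W') : VectorField.lieBracketWithin ℝ V W univ x =
      fderiv ℝ W' x (V' x) - fderiv ℝ V' x (W' x) := by
  rw [VectorField.lieBracketWithin_univ, hV.lieBracket_vectorField_eq hW,
    VectorField.lieBracket_eq]

theorem mlieBracket_eq_localRep (V W : ∀ x : N, TangentSpace I x) (p : N) :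
    VectorField.mlieBracket I V W p =
      fderiv ℝ (localRep I W p) (extChartAt I p p) (V p) -
        fderiv ℝ (localRep I V p) (extChartAt I p p) (W p) := by
  rw [← VectorField.mlieBracketWithin_univ, VectorField.mlieBracketWithin_apply]
  have hV : ∀ V : ∀ x : N, TangentSpace I x,
      VectorField.mpullbackWithin 𝓘(ℝ, E) I (extChartAt I p).symm V (range I)
        =ᶠ[𝓝 (extChartAt I p p)] localRep I V p := fun V ↦ by
    filter_upwards [extChartAt_target_mem_nhds (I := I) p] with z hz
    exact mpullbackWithin_extChartAt_symm_eq_localRep V p hz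
  -- The fibre over p is identified with E through the preferred chart at p itself, so the outer
  -- factor in the definition of the bracket disappears.
  have hid : mfderiv I 𝓘(ℝ, E) (extChartAt I p) p = ContinuousLinearMap.id ℝ E := by
    ext v
    have h := trivializationAt_snd_eq_mfderiv (I := I) p ⟨p, v⟩ (mem_chart_source H p)
    rw [trivializationAt_self] at h
    exact h.symm
  have hset : (extChartAt I p).symm ⁻¹' univ ∩ range I = univ := by
    rw [preimage_univ, univ_inter, I.range_eq_univ]
  have hinv : (mfderiv I 𝓘(ℝ, E) (extChartAt I p) p).inverse = ContinuousLinearMap.id ℝ E := by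
    rw [hid]
    exact ContinuousLinearMap.inverse_id
  refine (congrArg (fun L : E →L[ℝ] E ↦ L _) hinv).trans ?_
  change VectorField.lieBracketWithin ℝ _ _ ((extChartAt I p).symm ⁻¹' univ ∩ range I) _ = _
  rw [hset]
  refine (lieBracketWithin_univ_eq_of_eventuallyEq (hV V) (hV W)).trans ?_
  simp only [localRep_self]

theorem differentiableAt_localRep {V : ∀ x : N, TangentSpace I x} {p : N}
    (hV : MDifferentiableAt I I.tangent (fun x ↦ (⟨x, V x⟩ : TangentBundle I N)) p) :
    DifferentiableAt ℝ (localRep I V p) (extChartAt I p p) := by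
  rw [mdifferentiableAt_totalSpace] at hV
  have h1 := hV.2
  have h0 : ContMDiffOn 𝓘(ℝ, E) I ∞ (extChartAt I p).symm (extChartAt I p).target :=
    contMDiffOn_extChartAt_symm p
  have h2 : MDifferentiableAt 𝓘(ℝ, E) I (extChartAt I p).symm (extChartAt I p p) :=
    (h0.contMDiffAt (extChartAt_target_mem_nhds (I := I) p)).mdifferentiableAt (by simp)
  have h3 : MDifferentiableAt 𝓘(ℝ, E) 𝓘(ℝ, E) (localRep I V p) (extChartAt I p p) := by
    refine MDifferentiableAt.comp_of_eq (I' := I) (f := (extChartAt I p).symm)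
      (g := fun x ↦ (trivializationAt E (TangentSpace I) p (⟨x, V x⟩ : TangentBundle I N)).2) _
      h1 h2 (extChartAt_to_inv p)
  exact h3.differentiableAt

/-- In the charts at p and at V p the section is z ↦ (z, V(z)) with V replaced by its
representative; differentiating gives both components. -/
theorem tangentMap_section {V : ∀ x : N, TangentSpace I x} {p : N}
    (hV : MDifferentiableAt I I.tangent (fun x ↦ (⟨x, V x⟩ : TangentBundle I N)) p) (v : E) :
    tangentMap I I.tangent (fun x ↦ (⟨x, V x⟩ : TangentBundle I N)) ⟨p, v⟩ =
      (⟨⟨p, V p⟩, (v, fderiv ℝ (localRep I V p) (extChartAt I p p) v)⟩ : TT I N) := by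
  have h : HasMFDerivAt I I.tangent (fun x ↦ (⟨x, V x⟩ : TangentBundle I N)) p
      ((ContinuousLinearMap.id ℝ E).prod (fderiv ℝ (localRep I V p) (extChartAt I p p))) := by
    refine ⟨hV.continuousAt, ?_⟩
    have hw : ∀ z ∈ (extChartAt I p).target,
        writtenInExtChartAt I I.tangent p (fun x ↦ (⟨x, V x⟩ : TangentBundle I N)) z =
          (z, localRep I V p z) :=
      fun z hz ↦ Prod.ext ((extChartAt I p).right_inv hz) rfl
    have hd := ((hasFDerivAt_id (𝕜 := ℝ) (extChartAt I p p)).prodMk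
      (differentiableAt_localRep hV).hasFDerivAt).hasFDerivWithinAt (s := range I)
    refine HasFDerivWithinAt.congr_of_eventuallyEq hd ?_ (hw _ (mem_extChartAt_target p))
    filter_upwards [extChartAt_target_mem_nhdsWithin (I := I) p] with z hz using hw z hz
  simp only [tangentMap]
  rw [h.mfderiv]
  rfl

theorem linearization_section {V : ∀ x : N, TangentSpace I x} {p : N}
    (hV : MDifferentiableAt I I.tangent (fun x ↦ (⟨x, V x⟩ : TangentBundle I N)) p) (v : E) :
    linearization (fun x ↦ (⟨x, V x⟩ : TangentBundle I N)) ⟨p, v⟩ =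
      (⟨⟨p, v⟩, (V p, fderiv ℝ (localRep I V p) (extChartAt I p p) v)⟩ : TT I N) := by
  rw [linearization, tangentMap_section hV]
  rfl

/-- If `[W, V] = V` and `y' = V(y)`, then `Z = a V(y) + a' W(y)` with `a'` constant solves the
linearised equation `Z' = (κ ∘ DV)(Z)`. -/
theorem velocity_smul_add_smul {V W : ∀ x : N, TangentSpace I x} {y : ℝ → N} {a : ℝ → ℝ} {β t : ℝ}
    (hV : MDifferentiableAt I I.tangent (fun x ↦ (⟨x, V x⟩ : TangentBundle I N)) (y t))
    (hW : MDifferentiableAt I I.tangent (fun x ↦ (⟨x, W x⟩ : TangentBundle I N)) (y t))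
    (hy : MDifferentiableAt 𝓘(ℝ, ℝ) I y t) (hyV : velocity I y t = ⟨y t, V (y t)⟩)
    (ha : HasDerivAt a β t) (hbr : VectorField.mlieBracket I W V (y t) = V (y t)) :
    velocity I.tangent (fun s ↦ (⟨y s, a s • V (y s) + β • W (y s)⟩ : TangentBundle I N)) t =
      linearization (fun x ↦ (⟨x, V x⟩ : TangentBundle I N))
        ⟨y t, a t • V (y t) + β • W (y t)⟩ := by
  set p := y t with hp
  set Z : ℝ → TangentBundle I N := fun s ↦ ⟨y s, a s • V (y s) + β • W (y s)⟩ with hZ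
  -- The values V p and W p are named as vectors of E, so that the chart computation takes place in
  -- one fixed vector space.
  obtain ⟨v, hv⟩ : ∃ v : E, V p = v := ⟨_, rfl⟩
  obtain ⟨w, hw⟩ : ∃ w : E, W p = w := ⟨_, rfl⟩
  have hsrc : ∀ᶠ s in 𝓝 t, y s ∈ (chartAt H p).source :=
    hy.continuousAt.eventually ((chartAt H p).open_source.mem_nhds (mem_chart_source H p))
  have hyd : HasDerivAt (extChartAt I p ∘ y) v t := by
    have h1 : MDifferentiableAt 𝓘(ℝ, ℝ) 𝓘(ℝ, E) (extChartAt I p ∘ y) t :=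
      (mdifferentiableAt_extChartAt (mem_chart_source H p)).comp t hy
    have h2 := velocity_eq I hy rfl
    rw [hyV] at h2
    have h3 : V p = fderiv ℝ (extChartAt I p ∘ y) t 1 := mk_tangent_injective (E := E) (I := I) h2
    rw [← hv, h3]
    exact h1.differentiableAt.hasDerivAt
  have hrep : ∀ U : ∀ x : N, TangentSpace I x,
      MDifferentiableAt I I.tangent (fun x ↦ (⟨x, U x⟩ : TangentBundle I N)) p →
      HasDerivAt (fun s ↦ localRep I U p (extChartAt I p (y s)))
        (fderiv ℝ (localRep I U p) (extChartAt I p p) v) t := fun U hU ↦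
    HasFDerivAt.comp_hasDerivAt (f := extChartAt I p ∘ y) (f' := v) (l := localRep I U p) t
      (differentiableAt_localRep hU).hasFDerivAt hyd
  have htriv : (fun s ↦ (trivializationAt E (TangentSpace I) p (Z s)).2) =ᶠ[𝓝 t]
      fun s ↦ a s • localRep I V p (extChartAt I p (y s)) +
        β • localRep I W p (extChartAt I p (y s)) := by
    filter_upwards [hsrc] with s hs
    have hs' : y s ∈ (extChartAt I p).source := by rwa [extChartAt_source]
    simp only [localRep]
    rw [(extChartAt I p).left_inv hs']
    exact trivializationAt_smul_add_smul hs _ _ _ _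
  have hV0 : localRep I V p (extChartAt I p (y t)) = v := (localRep_self V p).trans hv
  have hd := ((ha.smul (hrep V hV)).add ((hrep W hW).const_smul β)).congr_of_eventuallyEq htriv
  rw [hV0] at hd
  have hmd : MDifferentiableAt 𝓘(ℝ, ℝ) I.tangent Z t := by
    refine (mdifferentiableAt_totalSpace (IB := I) (F := E) (E := TangentSpace I) Z).2 ⟨hy, ?_⟩
    exact hd.differentiableAt.mdifferentiableAt
  have hbr' : fderiv ℝ (localRep I V p) (extChartAt I p p) w -
      fderiv ℝ (localRep I W p) (extChartAt I p p) v = v := by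
    have := mlieBracket_eq_localRep (I := I) W V p
    rw [hbr, hv, hw] at this
    exact this.symm
  have hder : HasDerivAt (extChartAt I.tangent (Z t) ∘ Z) (v, fderiv ℝ (localRep I V p)
      (extChartAt I p p) (a t • v + β • w)) t := by
    have e : extChartAt I.tangent (Z t) ∘ Z = fun s ↦ ((extChartAt I p ∘ y) s,
        (trivializationAt E (TangentSpace I) p (Z s)).2) := rfl
    rw [e]
    convert hyd.prodMk hd using 2
    rw [map_add, map_smul, map_smul]
    -- Here x₁ = DV·w, x₂ = DW·v and x₃ = DV·v. The term βv comes from a' = β, and the bracket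
    -- identity x₁ − x₂ = v is what balances it.
    have h9 : ∀ x₁ x₂ x₃ : E, x₁ - x₂ = v → a t • x₃ + β • x₁ = a t • x₃ + β • v + β • x₂ := by
      rintro x₁ x₂ x₃ rfl
      module
    exact h9 _ _ _ hbr'
  have hfin : fderiv ℝ (extChartAt I.tangent (Z t) ∘ Z) t 1 = (v, fderiv ℝ (localRep I V p)
      (extChartAt I p p) (a t • v + β • w)) := hder.deriv
  have hL := linearization_section hV (a t • v + β • w)
  have hZv := velocity_eq I.tangent hmd rfl
  rw [hfin] at hZv
  subst hv hw
  exact hZv.trans hL.symm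

end LieDerivative

/-! ### Smoothness, existence and uniqueness of integral curves. -/

/-- Bootstrapping: if u is of class Cⁿ then so is u' = G ∘ u, hence u is of class Cⁿ⁺¹. -/
theorem contDiffOn_of_hasDerivAt {F : Type*} [NormedAddCommGroup F] [NormedSpace ℝ F] {G : F → F}
    {Ω : Set F} {u : ℝ → F} {K : Set ℝ} (hK : IsOpen K) (hG : ContDiffOn ℝ ∞ G Ω)
    (hu : ∀ t ∈ K, u t ∈ Ω ∧ HasDerivAt u (G (u t)) t) : ContDiffOn ℝ ∞ u K := by
  rw [contDiffOn_infty]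
  intro n
  induction n with
  | zero =>
    exact contDiffOn_zero.2 fun t ht ↦ (hu t ht).2.continuousAt.continuousWithinAt
  | succ n ih =>
    push_cast
    rw [contDiffOn_succ_iff_deriv_of_isOpen hK]
    refine ⟨fun t ht ↦ (hu t ht).2.differentiableAt.differentiableWithinAt, by simp, ?_⟩
    exact ((hG.of_le (by exact_mod_cast le_top)).comp ih fun t ht ↦ (hu t ht).1).congr
      fun t ht ↦ (hu t ht).2.deriv

section IntegralCurves

variable {E : Type*} [NormedAddCommGroup E] [NormedSpace ℝ E]
  {H : Type*} [TopologicalSpace H] {I : ModelWithCorners ℝ E H} [I.Boundaryless]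
  {N : Type*} [TopologicalSpace N] [ChartedSpace H N] [IsManifold I ∞ N]

/-- Uniqueness of integral curves is needed in TTTM, and this lets the Hausdorff property climb from
M. Vectors over distinct points are separated downstairs, vectors over one point by a
trivialisation. -/
theorem t2Space_tangentBundle [T2Space N] : T2Space (TangentBundle I N) := by
  refine ⟨fun ξ η hne ↦ ?_⟩
  by_cases hb : ξ.1 = η.1
  · set e := trivializationAt E (TangentSpace I) ξ.1
    have hξ : ξ ∈ e.source := e.mem_source.2 (FiberBundle.mem_baseSet_trivializationAt' ξ.1)
    have hη : η ∈ e.source := e.mem_source.2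
      (hb ▸ FiberBundle.mem_baseSet_trivializationAt' ξ.1)
    have hne' : e ξ ≠ e η := fun h ↦ hne (e.injOn hξ hη h)
    have hne2 : (e ξ).2 ≠ (e η).2 := by
      intro h
      refine hne' (Prod.ext ?_ h)
      rw [e.coe_fst hξ, e.coe_fst hη]
      exact hb
    obtain ⟨u, v, hu, hv, hξu, hηv, huv⟩ := t2_separation hne2
    refine ⟨e.source ∩ e ⁻¹' (Prod.snd ⁻¹' u), e.source ∩ e ⁻¹' (Prod.snd ⁻¹' v),
      e.continuousOn.isOpen_inter_preimage e.open_source (hu.preimage continuous_snd),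
      e.continuousOn.isOpen_inter_preimage e.open_source (hv.preimage continuous_snd),
      ⟨hξ, hξu⟩, ⟨hη, hηv⟩, ?_⟩
    exact disjoint_left.2 fun z hz hz' ↦ disjoint_left.1 huv hz.2 hz'.2
  · obtain ⟨u, v, hu, hv, hξu, hηv, huv⟩ := t2_separation hb
    exact ⟨TotalSpace.proj ⁻¹' u, TotalSpace.proj ⁻¹' v, isOpen_proj_preimage hu,
      isOpen_proj_preimage hv, hξu, hηv, huv.preimage _⟩

theorem hasMFDerivAt_of_velocity_eq {V : ∀ x : N, TangentSpace I x} {y : ℝ → N} {t : ℝ}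
    (hy : MDifferentiableAt 𝓘(ℝ, ℝ) I y t) (h : velocity I y t = ⟨y t, V (y t)⟩) :
    HasMFDerivAt 𝓘(ℝ, ℝ) I y t ((1 : ℝ →L[ℝ] ℝ).smulRight (V (y t))) := by
  have h1 : mfderiv 𝓘(ℝ, ℝ) I y t (1 : ℝ) = V (y t) := mk_tangent_injective (E := E) (I := I) h
  have h2 : mfderiv 𝓘(ℝ, ℝ) I y t = (1 : ℝ →L[ℝ] ℝ).smulRight (V (y t)) := by
    rw [← h1]
    refine ContinuousLinearMap.ext_ring (R₁ := ℝ) ?_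
    exact (one_smul ℝ _).symm
  exact h2 ▸ hy.hasMFDerivAt

theorem velocity_eq_of_hasMFDerivAt {V : ∀ x : N, TangentSpace I x} {y : ℝ → N} {t : ℝ}
    (h : HasMFDerivAt 𝓘(ℝ, ℝ) I y t ((1 : ℝ →L[ℝ] ℝ).smulRight (V (y t)))) :
    velocity I y t = ⟨y t, V (y t)⟩ := by
  simp only [velocity]
  rw [h.mfderiv]
  exact congrArg (TotalSpace.mk (y t)) (one_smul ℝ (V (y t)))

/-- In the chart at y(t₀) the curve solves an ordinary differential equation with smooth right-hand
side `localRep`, so the bootstrapping argument applies. -/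
theorem contMDiffOn_of_hasMFDerivAt {V : ∀ x : N, TangentSpace I x} {s : Set N} (hs : IsOpen s)
    (hV : ContMDiffOn I I.tangent ∞ (fun x ↦ (⟨x, V x⟩ : TangentBundle I N)) s) {y : ℝ → N}
    {K : Set ℝ} (hK : IsOpen K) (hys : MapsTo y K s)
    (hy : ∀ t ∈ K, HasMFDerivAt 𝓘(ℝ, ℝ) I y t ((1 : ℝ →L[ℝ] ℝ).smulRight (V (y t)))) :
    ContMDiffOn 𝓘(ℝ, ℝ) I ∞ y K := by
  intro t₀ ht₀
  apply ContMDiffAt.contMDiffWithinAt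
  set p := y t₀ with hp
  have hint : IsMIntegralCurveAt y V t₀ := by
    filter_upwards [hK.mem_nhds ht₀] with t ht using hy t ht
  have hev := hint.eventually_hasDerivAt
  set Ω : Set E := (extChartAt I p).target ∩ (extChartAt I p).symm ⁻¹' s with hΩdef
  have hΩ : IsOpen Ω := (continuousOn_extChartAt_symm p).isOpen_inter_preimage
    (isOpen_extChartAt_target p) hs
  have hG : ContDiffOn ℝ ∞ (localRep I V p) Ω := by
    rw [← contMDiffOn_iff_contDiffOn]
    have h0 : ContMDiffOn 𝓘(ℝ, E) I ∞ (extChartAt I p).symm (extChartAt I p).target :=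
      contMDiffOn_extChartAt_symm p
    have h1 : ContMDiffOn 𝓘(ℝ, E) I.tangent ∞ (fun z ↦ (⟨(extChartAt I p).symm z,
        V ((extChartAt I p).symm z)⟩ : TangentBundle I N)) Ω :=
      hV.comp (h0.mono inter_subset_left) fun z hz ↦ hz.2
    have h2 : MapsTo (fun z ↦ (⟨(extChartAt I p).symm z,
        V ((extChartAt I p).symm z)⟩ : TangentBundle I N)) Ω
        (trivializationAt E (TangentSpace I) p).source := fun z hz ↦ by
      have h3 := (extChartAt I p).map_target hz.1
      rwa [extChartAt_source] at h3
    exact ((Trivialization.contMDiffOn_iff h2).1 h1).2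
  have hev2 : ∀ᶠ t in 𝓝 t₀, t ∈ K ∧ y t ∈ (extChartAt I p).source :=
    (hK.eventually_mem ht₀).and ((hy t₀ ht₀).continuousAt.eventually
      (extChartAt_source_mem_nhds (I := I) p))
  obtain ⟨K', hK', hK'o, ht₀'⟩ := eventually_nhds_iff.1 (hev.and hev2)
  have hu : ContDiffOn ℝ ∞ (extChartAt I p ∘ y) K' := by
    refine contDiffOn_of_hasDerivAt (Ω := Ω) hK'o hG fun t ht ↦ ?_
    obtain ⟨hd, htK, hts⟩ := hK' t ht
    have hinv : (extChartAt I p).symm (extChartAt I p (y t)) = y t := (extChartAt I p).left_inv hts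
    refine ⟨⟨(extChartAt I p).map_source hts, ?_⟩, ?_⟩
    · simp only [mem_preimage, Function.comp_apply, hinv]
      exact hys htK
    · have e : localRep I V p ((extChartAt I p ∘ y) t) =
          tangentCoordChange I (y t) p (y t) (V (y t)) := by
        simp only [localRep, Function.comp_apply]
        rw [hinv]
        rfl
      rw [e]
      exact hd
  have h0 : ContMDiffOn 𝓘(ℝ, E) I ∞ (extChartAt I p).symm (extChartAt I p).target :=
    contMDiffOn_extChartAt_symm p
  have hfin := h0.comp hu.contMDiffOn fun t ht ↦ (extChartAt I p).map_source (hK' t ht).2.2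
  exact (hfin.congr fun t ht ↦ ((extChartAt I p).left_inv (hK' t ht).2.2).symm).contMDiffAt
    (hK'o.mem_nhds ht₀')

/-- Existence of smooth integral curves of a vector field that is smooth on an open set. -/
theorem exists_velocity_eq [CompleteSpace E] {V : ∀ x : N, TangentSpace I x} {s : Set N}
    (hs : IsOpen s) (hV : ContMDiffOn I I.tangent ∞ (fun x ↦ (⟨x, V x⟩ : TangentBundle I N)) s)
    {p : N} (hp : p ∈ s) :
    ∃ (ε : ℝ) (y : ℝ → N), 0 < ε ∧ y 0 = p ∧ ContMDiffOn 𝓘(ℝ, ℝ) I ∞ y (Ioo (-ε) ε) ∧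
      ∀ t ∈ Ioo (-ε) ε, y t ∈ s ∧ velocity I y t = ⟨y t, V (y t)⟩ := by
  obtain ⟨y, hy0, hy⟩ := exists_isMIntegralCurveAt_of_contMDiffAt_boundaryless (v := V) 0
    ((hV.contMDiffAt (hs.mem_nhds hp)).of_le (by norm_cast))
  have hys : ∀ᶠ t in 𝓝 (0 : ℝ), y t ∈ s :=
    hy.continuousAt.eventually (hs.mem_nhds (by rwa [hy0]))
  obtain ⟨ε, hε, hb⟩ := Metric.eventually_nhds_iff_ball.1 (hy.and hys)
  have hb' : ∀ t ∈ Ioo (-ε) ε, t ∈ Metric.ball (0 : ℝ) ε := fun t ht ↦ by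
    rw [Real.ball_eq_Ioo]
    simpa using ht
  refine ⟨ε, y, hε, hy0, ?_, fun t ht ↦ ⟨(hb t (hb' t ht)).2, ?_⟩⟩
  · exact contMDiffOn_of_hasMFDerivAt hs hV isOpen_Ioo (fun t ht ↦ (hb t (hb' t ht)).2)
      fun t ht ↦ (hb t (hb' t ht)).1
  · exact velocity_eq_of_hasMFDerivAt (hb t (hb' t ht)).1

/-- Uniqueness of integral curves of a vector field that is smooth on an open set. -/
theorem eqOn_of_velocity_eq [T2Space N] {V : ∀ x : N, TangentSpace I x} {s : Set N}
    (hs : IsOpen s) (hV : ContMDiffOn I I.tangent ∞ (fun x ↦ (⟨x, V x⟩ : TangentBundle I N)) s)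
    {y z : ℝ → N} {K : Set ℝ} (hK : IsOpen K) (hKc : K.OrdConnected)
    (hy : ∀ t ∈ K, MDifferentiableAt 𝓘(ℝ, ℝ) I y t) (hz : ∀ t ∈ K, MDifferentiableAt 𝓘(ℝ, ℝ) I z t)
    (hyV : ∀ t ∈ K, velocity I y t = ⟨y t, V (y t)⟩)
    (hzV : ∀ t ∈ K, velocity I z t = ⟨z t, V (z t)⟩) (hys : MapsTo y K s) {t₀ : ℝ} (ht₀ : t₀ ∈ K)
    (h0 : y t₀ = z t₀) : EqOn y z K := by
  have hyc : ContinuousOn y K := fun t ht ↦ (hy t ht).continuousAt.continuousWithinAt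
  have hzc : ContinuousOn z K := fun t ht ↦ (hz t ht).continuousAt.continuousWithinAt
  have hpre : IsPreconnected K := hKc.isPreconnected
  -- The coincidence set is open by local uniqueness and its complement in K is open because N is
  -- Hausdorff; K is connected.
  have hop : IsOpen {t | t ∈ K ∧ y t = z t} := by
    rw [isOpen_iff_mem_nhds]
    rintro t ⟨ht, he⟩
    have hyi : IsMIntegralCurveAt y V t := by
      filter_upwards [hK.mem_nhds ht] with r hr
      exact hasMFDerivAt_of_velocity_eq (hy r hr) (hyV r hr)
    have hzi : IsMIntegralCurveAt z V t := by
      filter_upwards [hK.mem_nhds ht] with r hr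
      exact hasMFDerivAt_of_velocity_eq (hz r hr) (hzV r hr)
    have := isMIntegralCurveAt_eventuallyEq_of_contMDiffAt_boundaryless
      ((hV.contMDiffAt (hs.mem_nhds (hys ht))).of_le (by norm_cast)) hyi hzi he
    filter_upwards [this, hK.mem_nhds ht] with r hr hrK using ⟨hrK, hr⟩
  have hop2 : IsOpen {t | t ∈ K ∧ y t ≠ z t} := by
    have h1 : IsOpen (K ∩ (fun t ↦ (y t, z t)) ⁻¹' (diagonal N)ᶜ) :=
      (hyc.prodMk hzc).isOpen_inter_preimage hK isClosed_diagonal.isOpen_compl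
    exact h1
  have hsub := hpre.subset_left_of_subset_union hop hop2
    (disjoint_left.2 fun t h1 h2 ↦ h2.2 h1.2)
    (fun t ht ↦ (em (y t = z t)).imp (fun h ↦ ⟨ht, h⟩) fun h ↦ ⟨ht, h⟩) ⟨t₀, ht₀, ht₀, h0⟩
  exact fun t ht ↦ (hsub ht).2

end IntegralCurves

/-! ### Slice charts from parametrisations with a left inverse. -/

section Submanifolds

variable {A : Type*} [NormedAddCommGroup A] [NormedSpace ℝ A] [FiniteDimensional ℝ A]
  {E : Type*} [NormedAddCommGroup E] [NormedSpace ℝ E] [FiniteDimensional ℝ E]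

/-- A smooth map with a left inverse that is differentiable at one point is straightened near this
point by a local diffeomorphism. -/
theorem exists_straightening {f : A → E} {r : E → A} {O : Set A} {a₀ : A} (hO : IsOpen O)
    (ha₀ : a₀ ∈ O) (hf : ContDiffOn ℝ ∞ f O) (hr : DifferentiableAt ℝ r (f a₀))
    (hrf : ∀ a ∈ O, r (f a) = a) :
    ∃ (e : OpenPartialHomeomorph E E) (L : Submodule ℝ E) (O' : Set A),
      f a₀ ∈ e.source ∧ ContDiffOn ℝ ∞ e e.source ∧ ContDiffOn ℝ ∞ e.symm e.target ∧
      Module.finrank ℝ L = Module.finrank ℝ A ∧ IsOpen O' ∧ a₀ ∈ O' ∧ O' ⊆ O ∧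
      ∀ z ∈ e.source, e z ∈ L ↔ ∃ a ∈ O', z = f a := by
  have hfd : ∀ a ∈ O, DifferentiableAt ℝ f a := fun a ha ↦
    (hf.contDiffAt (hO.mem_nhds ha)).differentiableAt (by simp)
  set f' := fderiv ℝ f a₀ with hf'
  set r' := fderiv ℝ r (f a₀) with hr'
  have hrf' : ∀ v, r' (f' v) = v := by
    have h1 : HasFDerivAt (r ∘ f) (r'.comp f') a₀ :=
      hr.hasFDerivAt.comp a₀ (hfd a₀ ha₀).hasFDerivAt
    have h2 : HasFDerivAt (r ∘ f) (ContinuousLinearMap.id ℝ A) a₀ := by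
      refine (hasFDerivAt_id a₀).congr_of_eventuallyEq ?_
      filter_upwards [hO.mem_nhds ha₀] with a ha using hrf a ha
    intro v
    exact congrArg (fun M : A →L[ℝ] A ↦ M v) (h1.unique h2)
  -- From r' ∘ f' = id one gets the splitting E = f'(A) ⊕ ker r', which supplies the directions
  -- transverse to the image of f.
  set K : Submodule ℝ E := LinearMap.ker (r' : E →ₗ[ℝ] A) with hK
  set T : A × K →L[ℝ] E := f'.coprod K.subtypeL with hT
  have hTbij : Function.Bijective T := by
    constructor
    · rw [injective_iff_map_eq_zero]
      rintro ⟨a, k⟩ hak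
      have hk : r' (k : E) = 0 := k.2
      have hak' : f' a + (k : E) = 0 := hak
      have ha : a = 0 := by
        have := congrArg r' hak'
        rwa [map_add, hrf', hk, add_zero, map_zero] at this
      subst ha
      rw [map_zero, zero_add] at hak'
      exact Prod.ext rfl (Subtype.ext hak')
    · intro z
      refine ⟨(r' z, ⟨z - f' (r' z), ?_⟩), ?_⟩
      · change r' (z - f' (r' z)) = 0
        rw [map_sub, hrf', sub_self]
      · change f' (r' z) + (z - f' (r' z)) = z
        abel
  set T' : (A × K) ≃L[ℝ] E :=
    (LinearEquiv.ofBijective (T : A × K →ₗ[ℝ] E) hTbij).toContinuousLinearEquiv with hT'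
  have hTT' : (T' : A × K →L[ℝ] E) = T := by ext <;> rfl
  set Ψ : A × K → E := fun x ↦ f x.1 + (x.2 : E) with hΨ
  set D : Set (A × K) := Prod.fst ⁻¹' O with hD
  have hDo : IsOpen D := hO.preimage continuous_fst
  have hΨs : ContDiffOn ℝ ∞ Ψ D :=
    (hf.comp contDiff_fst.contDiffOn fun x hx ↦ hx).add
      (K.subtypeL.contDiff.comp contDiff_snd).contDiffOn
  have h0D : (a₀, (0 : K)) ∈ D := ha₀
  have hΨ0 : ContDiffAt ℝ ∞ Ψ (a₀, 0) := hΨs.contDiffAt (hDo.mem_nhds h0D)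
  have hΨd : HasFDerivAt Ψ (T' : A × K →L[ℝ] E) (a₀, 0) := by
    rw [hTT']
    have h1 : HasFDerivAt (fun x : A × K ↦ f x.1)
        (f'.comp (ContinuousLinearMap.fst ℝ A K)) (a₀, 0) :=
      HasFDerivAt.comp (a₀, (0 : K)) (f := Prod.fst) (g := f) (hfd a₀ ha₀).hasFDerivAt hasFDerivAt_fst
    have h2 : HasFDerivAt (fun x : A × K ↦ (x.2 : E))
        (K.subtypeL.comp (ContinuousLinearMap.snd ℝ A K)) (a₀, 0) :=
      (K.subtypeL.comp (ContinuousLinearMap.snd ℝ A K)).hasFDerivAt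
    exact h1.add h2
  set e₁ := hΨ0.toOpenPartialHomeomorph Ψ hΨd (by simp) with he₁
  -- The local inverse of Ψ is smooth wherever the derivative of Ψ is invertible. This is an open
  -- condition, and restricting to it makes the inverse smooth on its whole domain.
  set R : Set (A × K) := {x | x ∈ D ∧ fderiv ℝ Ψ x ∈
    range ((↑) : ((A × K) ≃L[ℝ] E) → A × K →L[ℝ] E)} with hR
  have hRo : IsOpen R :=
    (hΨs.continuousOn_fderiv_of_isOpen hDo (by simp)).isOpen_inter_preimage hDo
      ContinuousLinearEquiv.isOpen
  have h0R : (a₀, (0 : K)) ∈ R := ⟨h0D, T', hΨd.fderiv.symm⟩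
  set e₂ := e₁.restrOpen R hRo with he₂
  have he₂s : e₂.source = e₁.source ∩ R := e₁.restrOpen_source R hRo
  have h0e : (a₀, (0 : K)) ∈ e₂.source := by
    rw [he₂s]
    exact ⟨hΨ0.mem_toOpenPartialHomeomorph_source hΨd (by simp), h0R⟩
  have he₂c : ∀ x, e₂ x = f x.1 + (x.2 : E) := fun x ↦ rfl
  have hsymm : ContDiffOn ℝ ∞ e₂.symm e₂.target := by
    intro z hz
    have hzs := e₂.map_target hz
    have hzR : e₂.symm z ∈ R := (he₂s ▸ hzs).2
    obtain ⟨T₁, hT₁⟩ := hzR.2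
    have hc : ContDiffAt ℝ ∞ Ψ (e₂.symm z) := hΨs.contDiffAt (hDo.mem_nhds hzR.1)
    have hd : HasFDerivAt Ψ (T₁ : A × K →L[ℝ] E) (e₂.symm z) := by
      rw [hT₁]
      exact (hc.differentiableAt (by simp)).hasFDerivAt
    exact (e₂.contDiffAt_symm hz hd hc).contDiffWithinAt
  -- Composing Ψ⁻¹ with the linear isomorphism T' returns to E and carries f(a) to f'(a), so the
  -- image of f becomes the linear subspace f'(A).
  set e₃ := e₂.symm.trans T'.toHomeomorph.toOpenPartialHomeomorph with he₃
  have he₃s : e₃.source = e₂.target := by simp [he₃]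
  have he₃t : e₃.target = T'.symm ⁻¹' e₂.source := by
    simp [he₃]
  have hLinj : LinearMap.ker (f' : A →ₗ[ℝ] E) = ⊥ := by
    rw [LinearMap.ker_eq_bot]
    intro v w hvw
    have := congrArg r' hvw
    simpa [hrf'] using this
  refine ⟨e₃, LinearMap.range (f' : A →ₗ[ℝ] E), (fun a ↦ (a, (0 : K))) ⁻¹' e₂.source,
    ?_, ?_, ?_, ?_, ?_, h0e, ?_, ?_⟩
  · rw [he₃s]
    have := e₂.map_source h0e
    rwa [he₂c, Submodule.coe_zero, add_zero] at this
  · rw [he₃s]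
    exact T'.contDiff.comp_contDiffOn hsymm
  · rw [he₃t]
    have h1 : ContDiffOn ℝ ∞ Ψ e₂.source := hΨs.mono (by rw [he₂s]; exact fun x hx ↦ hx.2.1)
    exact h1.comp T'.symm.contDiff.contDiffOn fun z hz ↦ hz
  · exact LinearMap.finrank_range_of_inj (LinearMap.ker_eq_bot.1 hLinj)
  · exact e₂.open_source.preimage (by fun_prop)
  · intro a ha
    have ha' : (a, (0 : K)) ∈ e₂.source := ha
    rw [he₂s] at ha'
    exact ha'.2.1
  · intro z hz
    rw [he₃s] at hz
    obtain ⟨⟨a, k⟩, hak⟩ : ∃ x, x = e₂.symm z := ⟨_, rfl⟩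
    have hak' : (a, k) ∈ e₂.source := hak ▸ e₂.map_target hz
    have hzeq : f a + (k : E) = z := by
      have := e₂.right_inv hz
      rwa [← hak] at this
    have he₃z : e₃ z = T (a, k) := by
      change T' (e₂.symm z) = _
      rw [← hak, ← hTT']
      rfl
    have hTak : ∀ a k, T (a, k) = f' a + (k : E) := fun _ _ ↦ rfl
    rw [he₃z]
    constructor
    · rintro ⟨a', ha'⟩
      have h1 : T (a', 0) = T (a, k) := by
        rw [hTak a', Submodule.coe_zero, add_zero]
        exact ha'
      obtain ⟨rfl, rfl⟩ := Prod.mk.inj (hTbij.1 h1)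
      refine ⟨a', hak', ?_⟩
      rw [← hzeq, Submodule.coe_zero, add_zero]
    · rintro ⟨a', ha', rfl⟩
      have h1 : e₂.symm (f a') = (a', 0) := by
        have := e₂.left_inv ha'
        rwa [he₂c, Submodule.coe_zero, add_zero] at this
      rw [h1] at hak
      obtain ⟨rfl, rfl⟩ := Prod.mk.inj hak
      exact ⟨a, by rw [hTak, Submodule.coe_zero, add_zero]; rfl⟩

variable {H : Type*} [TopologicalSpace H] {I : ModelWithCorners ℝ E H} [I.Boundaryless]
  {N : Type*} [TopologicalSpace N] [ChartedSpace H N] [IsManifold I ∞ N]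

/-- A set that near `p` is the image of a smooth map with a left inverse differentiable at `p` is
a linear slice in some chart around `p`. -/
theorem exists_slice_chart {B : Set N} {p : N} {F : A → N} {ρ : N → A} {O : Set A}
    (hO : IsOpen O) (hpO : ρ p ∈ O) (hF : ContMDiffOn 𝓘(ℝ, A) I ∞ F O)
    (hρ : MDifferentiableAt I 𝓘(ℝ, A) ρ p) (hFB : ∀ a ∈ O, F a ∈ B ∧ ρ (F a) = a)
    (hB : ∀ᶠ q in 𝓝 p, q ∈ B → F (ρ q) = q) (hp : p ∈ B) :
    ∃ φ ∈ IsManifold.maximalAtlas I ∞ N, p ∈ φ.source ∧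
      ∃ L : Submodule ℝ E, Module.finrank ℝ L = Module.finrank ℝ A ∧
        ∀ q ∈ φ.source, q ∈ B ↔ I (φ q) ∈ L := by
  have hFp : F (ρ p) = p := hB.self_of_nhds hp
  set O₁ : Set A := O ∩ F ⁻¹' (chartAt H p).source with hO₁
  have hO₁o : IsOpen O₁ := hF.continuousOn.isOpen_inter_preimage hO (chartAt H p).open_source
  have hpO₁ : ρ p ∈ O₁ := ⟨hpO, by rw [mem_preimage, hFp]; exact mem_chart_source H p⟩
  set f : A → E := fun a ↦ extChartAt I p (F a) with hf
  have hfs : ContDiffOn ℝ ∞ f O₁ := by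
    rw [← contMDiffOn_iff_contDiffOn]
    exact contMDiffOn_extChartAt.comp (hF.mono inter_subset_left) fun a ha ↦ ha.2
  have hfp : f (ρ p) = extChartAt I p p := by simp only [hf, hFp]
  set r : E → A := fun z ↦ ρ ((extChartAt I p).symm z) with hr
  have hrd : DifferentiableAt ℝ r (f (ρ p)) := by
    rw [hfp, ← mdifferentiableAt_iff_differentiableAt]
    have h0 : ContMDiffOn 𝓘(ℝ, E) I ∞ (extChartAt I p).symm (extChartAt I p).target :=
      contMDiffOn_extChartAt_symm p
    have h2 : MDifferentiableAt 𝓘(ℝ, E) I (extChartAt I p).symm (extChartAt I p p) :=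
      (h0.contMDiffAt (extChartAt_target_mem_nhds (I := I) p)).mdifferentiableAt (by simp)
    exact MDifferentiableAt.comp_of_eq (I' := I) (f := (extChartAt I p).symm) (g := ρ) _
      hρ h2 (extChartAt_to_inv p)
  have hsrc : ∀ q ∈ (chartAt H p).source, (extChartAt I p).symm (extChartAt I p q) = q :=
    fun q hq ↦ (extChartAt I p).left_inv (by rwa [extChartAt_source])
  have hrf : ∀ a ∈ O₁, r (f a) = a := by
    intro a ha
    simp only [hr, hf]
    rw [hsrc _ ha.2, (hFB a ha.1).2]
  obtain ⟨e, L, O', h0e, hes, het, hL, hO'o, hpO', hO'sub, hslice⟩ :=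
    exists_straightening hO₁o hpO₁ hfs hrd hrf
  -- On W every point of B is F(ρ(q)) with ρ(q) in the domain of the straightened piece. Restricting
  -- the chart to W excludes any other part of B.
  obtain ⟨W, hWp, hWo, hpW⟩ := eventually_nhds_iff.1
    (hB.and (hρ.continuousAt.eventually (hO'o.mem_nhds hpO')))
  -- The straightening acts on E while charts take values in H; conjugation by the homeomorphism I
  -- mediates between them.
  set hI := I.toHomeomorph.toOpenPartialHomeomorph with hIdef
  set φ : OpenPartialHomeomorph N H :=
    (((chartAt H p).restrOpen W hWo).trans hI).trans (e.trans hI.symm) with hφ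
  have hφs : ∀ q, q ∈ φ.source ↔ (q ∈ (chartAt H p).source ∧ q ∈ W) ∧ extChartAt I p q ∈ e.source := by
    intro q
    simp [hφ, hIdef]
  have hIr : ∀ z : E, I (I.symm z) = z := fun z ↦ I.right_inv (by rw [I.range_eq_univ]; trivial)
  have hφt : ∀ z, z ∈ φ.target ↔ I z ∈ e.target ∧ e.symm (I z) ∈ (extChartAt I p).target ∧
      (extChartAt I p).symm (e.symm (I z)) ∈ W := by
    intro z
    simp [hφ, hIdef]
    exact fun _ _ _ ↦ ⟨_, hIr _⟩
  have hφc : ∀ q, φ q = I.symm (e (extChartAt I p q)) := fun q ↦ rfl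
  have hφc' : ∀ z, φ.symm z = (extChartAt I p).symm (e.symm (I z)) := fun q ↦ rfl
  refine ⟨φ, φ.mem_maximalAtlas_of_contMDiffOn ?_ ?_, ?_, L, hL, ?_⟩
  · have h1 : ContMDiffOn I 𝓘(ℝ, E) ∞ (extChartAt I p) φ.source :=
      contMDiffOn_extChartAt.mono fun q hq ↦ ((hφs q).1 hq).1.1
    have h2 : ContMDiffOn I 𝓘(ℝ, E) ∞ (fun q ↦ e (extChartAt I p q)) φ.source :=
      hes.contMDiffOn.comp h1 fun q hq ↦ ((hφs q).1 hq).2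
    exact (I.contMDiffOn_symm (n := ∞)).comp h2 fun q hq ↦ by rw [I.range_eq_univ]; trivial
  · have h1 : ContMDiffOn I 𝓘(ℝ, E) ∞ (fun z ↦ e.symm (I z)) φ.target :=
      het.contMDiffOn.comp (I.contMDiff (n := ∞)).contMDiffOn fun z hz ↦ ((hφt z).1 hz).1
    exact (contMDiffOn_extChartAt_symm p).comp h1 fun z hz ↦ ((hφt z).1 hz).2.1
  · rw [hφs]
    exact ⟨⟨mem_chart_source H p, hpW⟩, hfp ▸ h0e⟩
  · intro q hq
    rw [hφs] at hq
    rw [hφc, hIr, hslice _ hq.2]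
    constructor
    · intro hqB
      refine ⟨ρ q, (hWp q hq.1.2).2, ?_⟩
      simp only [hf]
      rw [(hWp q hq.1.2).1 hqB]
    · rintro ⟨a, ha, hqa⟩
      have ha1 := hO'sub ha
      have : q = F a := by
        rw [← hsrc q hq.1.1, hqa]
        exact hsrc _ ha1.2
      rw [this]
      exact (hFB a ha1.1).1

end Submanifolds

/-! ### Slashed bundles. -/

section Slashed

variable {E : Type*} [NormedAddCommGroup E] [NormedSpace ℝ E]
  {H : Type*} [TopologicalSpace H] {I : ModelWithCorners ℝ E H}
  {M : Type*} [TopologicalSpace M] [ChartedSpace H M] [IsManifold I ∞ M]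
  {F : Type*} [NormedAddCommGroup F] [NormedSpace ℝ F]
  {G : Type*} [TopologicalSpace G] {J : ModelWithCorners ℝ F G}
  {N : Type*} [TopologicalSpace N] [ChartedSpace G N] [IsManifold J ∞ N]

theorem mem_slashed_id {y : TangentBundle I M} : y ∈ slashed I I (id : M → M) ↔ y.2 ≠ 0 := by
  simp only [slashed]
  rw [tangentMap_id]
  rfl

theorem mem_slashed_iff {p : N → M} {ξ : TangentBundle J N} :
    ξ ∈ slashed I J p ↔ tangentMap J I p ξ ∈ slashed I I (id : M → M) :=
  mem_slashed_id.symm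

/-- Trivialisations are linear isomorphisms on fibres, so being nonzero is the open condition that
the fibre coordinate is nonzero. -/
theorem isOpen_slashed_id : IsOpen (slashed I I (id : M → M)) := by
  rw [isOpen_iff_mem_nhds]
  intro y hy
  set e := trivializationAt E (TangentSpace I) y.1 with he
  have hye : y ∈ e.source := e.mem_source.2 (FiberBundle.mem_baseSet_trivializationAt' y.1)
  have h1 : IsOpen (e.source ∩ e ⁻¹' (Prod.snd ⁻¹' {0}ᶜ)) :=
    e.continuousOn.isOpen_inter_preimage e.open_source
      (isOpen_compl_singleton.preimage continuous_snd)
  have key : ∀ z ∈ e.source, ((e z).2 = 0 ↔ z.2 = 0) := by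
    intro z hz
    have hl : (e z).2 = e.continuousLinearEquivAt ℝ z.1 (e.mem_source.1 hz) z.2 := rfl
    rw [hl, map_eq_zero_iff _ (ContinuousLinearEquiv.injective _)]
  filter_upwards [h1.mem_nhds ⟨hye, fun h ↦ mem_slashed_id.1 hy ((key y hye).1 h)⟩] with z hz
  exact mem_slashed_id.2 fun h ↦ hz.2 ((key z hz.1).2 h)

end Slashed

/-! ### The Liouville field and second-order coordinates on TTM. -/

section SecondOrder

variable {E : Type*} [NormedAddCommGroup E] [NormedSpace ℝ E]
  {H : Type*} [TopologicalSpace H] {I : ModelWithCorners ℝ E H} [I.Boundaryless]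
  {M : Type*} [TopologicalSpace M] [ChartedSpace H M] [IsManifold I ∞ M]

theorem mk_eq_of_proj_eq {ξ : TangentBundle I M} {x : M} (h : ξ.1 = x) (v : E)
    (hv : v = ξ.2) : (⟨x, v⟩ : TangentBundle I M) = ξ := by
  subst h hv
  rfl

/-- The base coordinates of the trivialisation of `TTM` are those of `Dπ`. -/
theorem fst_trivializationAt_tangent (p : TangentBundle I M) (ξ : TT I M)
    (hξ : ξ.1.1 ∈ (chartAt H p.1).source) :
    Prod.fst (α := E) (β := E) (trivializationAt (E × E) (TangentSpace I.tangent) p ξ).2 =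
      (trivializationAt E (TangentSpace I) p.1
        (tangentMap I.tangent I TotalSpace.proj ξ)).2 := by
  have hξ' : ξ.1 ∈ (chartAt (ModelProd H E) p).source := by simpa using hξ
  have hπ : (tangentMap I.tangent I (TotalSpace.proj : TangentBundle I M → M) ξ).1 ∈
      (chartAt H p.1).source := hξ
  rw [trivializationAt_snd_eq_mfderiv p ξ hξ', trivializationAt_snd_eq_mfderiv p.1 _ hπ]
  have h1 : MDifferentiableAt I.tangent 𝓘(ℝ, E × E) (extChartAt I.tangent p) ξ.1 :=
    mdifferentiableAt_extChartAt hξ'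
  have h2 : MDifferentiableAt I 𝓘(ℝ, E) (extChartAt I p.1) ξ.1.1 :=
    mdifferentiableAt_extChartAt hξ
  have h3 := mfderiv_comp ξ.1 h2 (mdifferentiableAt_tangent_proj ξ.1)
  have h4 := mfderiv_comp (I'' := 𝓘(ℝ, E)) (g := (Prod.fst : E × E → E)) ξ.1
    (ContinuousLinearMap.fst ℝ E E).differentiableAt.mdifferentiableAt h1
  -- The chart of TM covers the chart of M; the claim is the chain rule applied to both sides of
  -- this identity.
  have h5 : (Prod.fst : E × E → E) ∘ extChartAt I.tangent p =
    extChartAt I p.1 ∘ (TotalSpace.proj : TangentBundle I M → M) := rfl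
  rw [h5, h3, mfderiv_eq_fderiv] at h4
  have h6 : fderiv ℝ (Prod.fst : E × E → E) (extChartAt I.tangent p ξ.1) =
    ContinuousLinearMap.fst ℝ E E := fderiv_fst
  rw [h6] at h4
  exact (congrArg (fun L : E × E →L[ℝ] E ↦ L ξ.2) h4).symm

/-- The Liouville vector at (x, v) is the velocity at s = 1 of the ray s ↦ (x, sv). In every induced
chart this ray has constant base point and linear fibre coordinate. -/
theorem trivializationAt_liouville (p y : TangentBundle I M)
    (hy : y.1 ∈ (chartAt H p.1).source) :
    (trivializationAt (E × E) (TangentSpace I.tangent) p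
      (⟨y, liouville I y⟩ : TT I M)).2 =
      ((0 : E), (trivializationAt E (TangentSpace I) p.1 y).2) := by
  obtain ⟨x, v⟩ := y
  set Γ : ℝ → TangentBundle I M := fun s ↦ ⟨x, s • v⟩ with hΓ
  have htriv : ∀ q : TangentBundle I M, x ∈ (chartAt H q.1).source → ∀ s,
      extChartAt I.tangent q (Γ s) =
        (extChartAt I q.1 x, s • (trivializationAt E (TangentSpace I) q.1
          (⟨x, v⟩ : TangentBundle I M)).2) := by
    intro q hq s
    exact Prod.ext rfl (trivializationAt_smul hq s v)
  have hder : ∀ q : TangentBundle I M, x ∈ (chartAt H q.1).source →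
      HasDerivAt (extChartAt I.tangent q ∘ Γ) ((0 : E), (trivializationAt E (TangentSpace I) q.1
          (⟨x, v⟩ : TangentBundle I M)).2) 1 := by
    intro q hq
    have e : extChartAt I.tangent q ∘ Γ = fun s ↦ (extChartAt I q.1 x,
      s • (trivializationAt E (TangentSpace I) q.1 (⟨x, v⟩ : TangentBundle I M)).2) :=
      funext (htriv q hq)
    rw [e]
    simpa using (hasDerivAt_const (1 : ℝ) (extChartAt I q.1 x)).prodMk
      ((hasDerivAt_id (1 : ℝ)).smul_const
        (trivializationAt E (TangentSpace I) q.1 (⟨x, v⟩ : TangentBundle I M)).2)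
  have hx := mem_chart_source H x
  have h1 : Γ 1 = ⟨x, v⟩ := by simp [hΓ]
  have hmd : MDifferentiableAt 𝓘(ℝ, ℝ) I.tangent Γ 1 := by
    refine (mdifferentiableAt_totalSpace (IB := I) (F := E) (E := TangentSpace I) Γ).2
      ⟨mdifferentiableAt_const, ?_⟩
    have := (hder (Γ 1) hx).differentiableAt.snd
    exact this.mdifferentiableAt
  have hvel : velocity I.tangent Γ 1 = ⟨⟨x, v⟩, liouville I ⟨x, v⟩⟩ := by
    rw [velocity_eq I.tangent hmd h1]
    have h2 : fderiv ℝ (extChartAt I.tangent (⟨x, v⟩ : TangentBundle I M) ∘ Γ) 1 1 =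
      ((0 : E), (trivializationAt E (TangentSpace I) x (⟨x, v⟩ : TangentBundle I M)).2) :=
      (hder ⟨x, v⟩ hx).deriv
    rw [h2, trivializationAt_self]
    rfl
  rw [← hvel, trivializationAt_velocity I.tangent hmd p (by simpa using hy)]
  exact (hder p hy).deriv

theorem contMDiff_liouville :
    ContMDiff I.tangent I.tangent.tangent ∞ (fun y : TangentBundle I M ↦
      (⟨y, liouville I y⟩ : TT I M)) := by
  intro p
  rw [contMDiffAt_totalSpace]
  refine ⟨contMDiffAt_id, ?_⟩
  have h1 := (contMDiffAt_totalSpace.1 (contMDiffAt_id (n := ∞) (I := I.tangent) (x := p))).2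
  have h2 : ContMDiffAt I.tangent 𝓘(ℝ, E × E) ∞ (fun y : TangentBundle I M ↦
      ((0 : E), (trivializationAt E (TangentSpace I) p.1 y).2)) p :=
    contMDiffAt_const.prodMk_space h1
  refine h2.congr_of_eventuallyEq ?_
  filter_upwards [(isOpen_proj_preimage (I := I) (chartAt H p.1).open_source).mem_nhds
    (mem_chart_source H p.1)] with y hy
  exact trivializationAt_liouville p y hy

variable {E₁ : Type*} [NormedAddCommGroup E₁] [NormedSpace ℝ E₁]
  {H₁ : Type*} [TopologicalSpace H₁] {I₁ : ModelWithCorners ℝ E₁ H₁}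
  {P : Type*} [TopologicalSpace P] [ChartedSpace H₁ P]

theorem contMDiffAt_smul_add_smul {f : P → M} {V W : ∀ x : M, TangentSpace I x} {a b : P → ℝ}
    {x₀ : P} (hV : ContMDiffAt I₁ I.tangent ∞ (fun x ↦ (⟨f x, V (f x)⟩ : TangentBundle I M)) x₀)
    (hW : ContMDiffAt I₁ I.tangent ∞ (fun x ↦ (⟨f x, W (f x)⟩ : TangentBundle I M)) x₀)
    (ha : ContMDiffAt I₁ 𝓘(ℝ, ℝ) ∞ a x₀) (hb : ContMDiffAt I₁ 𝓘(ℝ, ℝ) ∞ b x₀) :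
    ContMDiffAt I₁ I.tangent ∞
      (fun x ↦ (⟨f x, a x • V (f x) + b x • W (f x)⟩ : TangentBundle I M)) x₀ := by
  rw [contMDiffAt_totalSpace] at hV hW ⊢
  refine ⟨hV.1, ?_⟩
  refine ((ha.smul hV.2).add (hb.smul hW.2)).congr_of_eventuallyEq ?_
  filter_upwards [hV.1.continuousAt.eventually
    ((chartAt H (f x₀)).open_source.mem_nhds (mem_chart_source H (f x₀)))] with x hx
  exact trivializationAt_smul_add_smul hx _ _ _ _

/-- The field `κ ∘ J'` of `J = a c'`. -/
theorem canonicalInvolution_velocity_smul {c : ℝ → M} {K : Set ℝ} (hK : IsOpen K)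
    (hc : ContMDiffOn 𝓘(ℝ, ℝ) I ∞ c K) {a : ℝ → ℝ} {β t : ℝ} (ht : t ∈ K)
    (ha : HasDerivAt a β t) {w : TangentSpace I.tangent (velocity I c t)}
    (hw : velocity I.tangent (velocity I c) t = ⟨velocity I c t, w⟩) :
    canonicalInvolution I (velocity I.tangent
      (fun s ↦ (⟨c s, a s • (velocity I c s).2⟩ : TangentBundle I M)) t) =
      ⟨velocity I c t, a t • w + β • liouville I (velocity I c t)⟩ := by
  have hct : MDifferentiableAt 𝓘(ℝ, ℝ) I c t :=
    (hc.contMDiffAt (hK.mem_nhds ht)).mdifferentiableAt (by simp)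
  have hyt : MDifferentiableAt 𝓘(ℝ, ℝ) I.tangent (velocity I c) t :=
    ((contMDiffOn_velocity hK hc).contMDiffAt (hK.mem_nhds ht)).mdifferentiableAt (by simp)
  set Y : ℝ → TangentBundle I M := fun s ↦ ⟨c s, a s • (velocity I c s).2⟩ with hY
  set u : ℝ → E := fun s ↦ (trivializationAt E (TangentSpace I) (c t) (velocity I c s)).2 with hu
  have hud : DifferentiableAt ℝ u t :=
    ((mdifferentiableAt_totalSpace (IB := I) (F := E) (E := TangentSpace I)
      (velocity I c)).1 hyt).2.differentiableAt
  have hφ : DifferentiableAt ℝ (extChartAt I (c t) ∘ c) t :=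
    ((mdifferentiableAt_extChartAt (mem_chart_source H (c t))).comp t hct).differentiableAt
  have hut : u t = (velocity I c t).2 := trivializationAt_self (c t) _
  have hvel : velocity I c t = ⟨c t, (fderiv ℝ (extChartAt I (c t) ∘ c) t 1 : E)⟩ :=
    velocity_eq I hct rfl
  have hS : velocity I.tangent (velocity I c) t = (⟨velocity I c t,
      (fderiv ℝ (extChartAt I (c t) ∘ c) t 1, fderiv ℝ u t 1)⟩ : TT I M) := by
    rw [velocity_eq I.tangent hyt rfl]
    have h : HasDerivAt (extChartAt I.tangent (velocity I c t) ∘ velocity I c)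
      (fderiv ℝ (extChartAt I (c t) ∘ c) t 1, fderiv ℝ u t 1) t :=
      hφ.hasDerivAt.prodMk hud.hasDerivAt
    exact congrArg (TotalSpace.mk (velocity I c t)) h.deriv
  have hYt : (fun s ↦ (trivializationAt E (TangentSpace I) (c t) (Y s)).2) =ᶠ[𝓝 t]
      fun s ↦ a s • u s := by
    filter_upwards [hct.continuousAt.eventually
      ((chartAt H (c t)).open_source.mem_nhds (mem_chart_source H (c t)))] with s hs
    exact trivializationAt_smul (I := I) hs (a s) (velocity I c s).2
  have hYd := (ha.smul hud.hasDerivAt).congr_of_eventuallyEq hYt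
  have hYm : MDifferentiableAt 𝓘(ℝ, ℝ) I.tangent Y t :=
    (mdifferentiableAt_totalSpace (IB := I) (F := E) (E := TangentSpace I) Y).2
      ⟨hct, hYd.differentiableAt.mdifferentiableAt⟩
  -- In coordinates Y = (c, au), where u represents c', so Y' = (c, au, c', au' + βu). The
  -- involution exchanges the two middle entries, leaving (c, c', ac', au' + βu), which is ac'' +
  -- βE(c').
  have hYv : velocity I.tangent Y t = (⟨Y t, (fderiv ℝ (extChartAt I (c t) ∘ c) t 1,
      a t • fderiv ℝ u t 1 + β • u t)⟩ : TT I M) := by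
    rw [velocity_eq I.tangent hYm rfl]
    have h : HasDerivAt (extChartAt I.tangent (Y t) ∘ Y) (fderiv ℝ (extChartAt I (c t) ∘ c) t 1,
      a t • fderiv ℝ u t 1 + β • u t) t := hφ.hasDerivAt.prodMk hYd
    exact congrArg (TotalSpace.mk (Y t)) h.deriv
  rw [hYv]
  have hw' : w = (fderiv ℝ (extChartAt I (c t) ∘ c) t 1, fderiv ℝ u t 1) :=
    mk_tangent_injective (E := E × E) (I := I.tangent) (hw.symm.trans hS)
  subst hw'
  have hv2 : (velocity I c t).2 = fderiv ℝ (extChartAt I (c t) ∘ c) t 1 :=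
    mk_tangent_injective (E := E) (I := I) hvel
  have hb : (⟨c t, (fderiv ℝ (extChartAt I (c t) ∘ c) t 1 : E)⟩ : TangentBundle I M) =
    velocity I c t := hvel.symm
  refine (show _ = (⟨⟨c t, (fderiv ℝ (extChartAt I (c t) ∘ c) t 1 : E)⟩,
    (a t • (velocity I c t).2, a t • fderiv ℝ u t 1 + β • u t)⟩ : TT I M) from rfl).trans ?_
  refine (congrArg₂ (fun (p : TangentBundle I M) (w : E × E) ↦ (⟨p, w⟩ : TT I M)) hb ?_)
  refine Prod.ext ?_ ?_
  · change a t • (velocity I c t).2 = a t • fderiv ℝ (extChartAt I (c t) ∘ c) t 1 + β • (0 : E)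
    rw [hv2, smul_zero, add_zero]
    rfl
  · exact congrArg (fun z : E ↦ a t • fderiv ℝ u t 1 + β • z) hut

end SecondOrder

/-! ### Sprays: description of Δ and geodesic invariance. -/

section SprayFacts

variable {E : Type*} [NormedAddCommGroup E] [NormedSpace ℝ E]
  {H : Type*} [TopologicalSpace H] {I : ModelWithCorners ℝ E H} [I.Boundaryless]
  {M : Type*} [TopologicalSpace M] [ChartedSpace H M] [IsManifold I ∞ M]
  {S : ∀ y : TangentBundle I M, TangentSpace I.tangent y}

variable (I) in
/-- The subbundle of `T(TM∖0)` spanned by `S` and the Liouville vector field. -/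
def sprayLiouvilleSpan (S : ∀ y : TangentBundle I M, TangentSpace I.tangent y) : Set (TT I M) :=
  {q | ∃ y ∈ slashed I I (id : M → M), ∃ α β : ℝ, q = ⟨y, α • S y + β • liouville I y⟩}

theorem contMDiffAt_span_curve (hS : IsSpray I S) {y : ℝ → TangentBundle I M} {a : ℝ → ℝ} {β t : ℝ}
    (hy : ContMDiffAt 𝓘(ℝ, ℝ) I.tangent ∞ y t) (ha : ContDiffAt ℝ ∞ a t)
    (hyt : y t ∈ slashed I I (id : M → M)) :
    ContMDiffAt 𝓘(ℝ, ℝ) I.tangent.tangent ∞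
      (fun s ↦ (⟨y s, a s • S (y s) + β • liouville I (y s)⟩ : TT I M)) t :=
  contMDiffAt_smul_add_smul
    ((hS.smooth.contMDiffAt (isOpen_slashed_id.mem_nhds hyt)).comp t hy)
    ((contMDiff_liouville (y t)).comp t hy) ha.contMDiffAt contMDiffAt_const

/-- The homogeneity [E, S] = S enters the argument here, with S and E as the two fields of
`velocity_smul_add_smul`. -/
theorem velocity_span_curve (hS : IsSpray I S) {y : ℝ → TangentBundle I M} {a : ℝ → ℝ} {β t : ℝ}
    (hy : MDifferentiableAt 𝓘(ℝ, ℝ) I.tangent y t) (ha : HasDerivAt a β t)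
    (hyt : y t ∈ slashed I I (id : M → M)) (hyS : velocity I.tangent y t = fieldMap I S (y t)) :
    velocity I.tangent.tangent
      (fun s ↦ (⟨y s, a s • S (y s) + β • liouville I (y s)⟩ : TT I M)) t =
      linearization (fieldMap I S) ⟨y t, a t • S (y t) + β • liouville I (y t)⟩ :=
  velocity_smul_add_smul
    ((hS.smooth.contMDiffAt (isOpen_slashed_id.mem_nhds hyt)).mdifferentiableAt (by simp))
    ((contMDiff_liouville (y t)).mdifferentiableAt (by simp)) hy hyS ha (hS.homogeneous _ hyt)

/-- The curve `κ ∘ J'` for `J = a c'`, where `c` is a geodesic and `a` is affine. -/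
theorem canonicalInvolution_velocity_jacobi {c : ℝ → M} {K : Set ℝ} (hK : IsOpen K)
    (hc : IsGeodesicOn I I id (fieldMap I S) c K) {a : ℝ → ℝ} {β t : ℝ} (ht : t ∈ K)
    (ha : HasDerivAt a β t) :
    canonicalInvolution I (velocity I.tangent
      (fun s ↦ (⟨c s, a s • (velocity I c s).2⟩ : TangentBundle I M)) t) =
      ⟨velocity I c t, a t • S (velocity I c t) + β • liouville I (velocity I c t)⟩ :=
  canonicalInvolution_velocity_smul hK hc.1 ht ha (hc.2 t ht).2

theorem velocity_canonicalInvolution_velocity_jacobi (hS : IsSpray I S) {c : ℝ → M} {K : Set ℝ}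
    (hK : IsOpen K) (hc : IsGeodesicOn I I id (fieldMap I S) c K) {Y : ℝ → TangentBundle I M}
    {α β t : ℝ} (hY : ∀ t ∈ K, Y t = ⟨c t, α • (velocity I c t).2 + (β * t) • (velocity I c t).2⟩)
    (ht : t ∈ K) :
    (fun s ↦ canonicalInvolution I (velocity I.tangent Y s)) =ᶠ[𝓝 t]
      (fun s ↦ (⟨velocity I c s, (α + β * s) • S (velocity I c s) +
        β • liouville I (velocity I c s)⟩ : TT I M)) ∧
    velocity I.tangent.tangent (fun s ↦ canonicalInvolution I (velocity I.tangent Y s)) t =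
      linearization (fieldMap I S) ⟨velocity I c t, (α + β * t) • S (velocity I c t) +
        β • liouville I (velocity I c t)⟩ := by
  have ha : ∀ t, HasDerivAt (fun t : ℝ ↦ α + β * t) β t := fun t ↦ by
    simpa using ((hasDerivAt_id t).const_mul β).const_add α
  have hev : (fun s ↦ canonicalInvolution I (velocity I.tangent Y s)) =ᶠ[𝓝 t]
      (fun s ↦ (⟨velocity I c s, (α + β * s) • S (velocity I c s) +
        β • liouville I (velocity I c s)⟩ : TT I M)) := by
    filter_upwards [hK.mem_nhds ht] with s hs
    rw [← canonicalInvolution_velocity_jacobi hK hc hs (ha s)]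
    congr 1
    apply velocity_congr
    filter_upwards [hK.mem_nhds hs] with r hr
    rw [hY r hr]
    exact congrArg (TotalSpace.mk (c r)) (add_smul _ _ _).symm
  refine ⟨hev, ?_⟩
  rw [velocity_congr hev]
  exact velocity_span_curve hS (((contMDiffOn_velocity hK hc.1).contMDiffAt
    (hK.mem_nhds ht)).mdifferentiableAt (by simp)) (ha t) (hc.2 t ht).1 (hc.2 t ht).2

theorem mdifferentiableAt_fieldMap (hS : IsSpray I S) {y : TangentBundle I M}
    (hy : y ∈ slashed I I (id : M → M)) :
    MDifferentiableAt I.tangent I.tangent.tangent (fieldMap I S) y :=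
  (hS.smooth.contMDiffAt (isOpen_slashed_id.mem_nhds hy)).mdifferentiableAt (by simp)

/-- Since Dπ ∘ S = id, an integral curve y of S is the velocity of its own projection π ∘ y, which
is therefore a geodesic. -/
theorem exists_geodesic [CompleteSpace E] (hS : IsSpray I S) {y₀ : TangentBundle I M}
    (hy₀ : y₀ ∈ slashed I I (id : M → M)) :
    ∃ (ε : ℝ) (c : ℝ → M), 0 < ε ∧ IsGeodesicOn I I id (fieldMap I S) c (Ioo (-ε) ε) ∧
      velocity I c 0 = y₀ := by
  obtain ⟨ε, y, hε, hy0, hys, hyV⟩ := exists_velocity_eq isOpen_slashed_id hS.smooth hy₀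
  have hmd : ∀ t ∈ Ioo (-ε) ε, MDifferentiableAt 𝓘(ℝ, ℝ) I.tangent y t := fun t ht ↦
    (hys.contMDiffAt (isOpen_Ioo.mem_nhds ht)).mdifferentiableAt (by simp)
  have hc : ∀ t ∈ Ioo (-ε) ε, velocity I (TotalSpace.proj ∘ y) t = y t := fun t ht ↦ by
    rw [← tangentMap_velocity (mdifferentiableAt_tangent_proj _) (hmd t ht), (hyV t ht).2]
    exact hS.projection _ (hyV t ht).1
  have h0 : (0 : ℝ) ∈ Ioo (-ε) ε := by simpa using hε
  refine ⟨ε, TotalSpace.proj ∘ y, hε, ⟨contMDiff_tangent_proj.comp_contMDiffOn hys, ?_⟩,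
    by rw [hc 0 h0, hy0]⟩
  intro t ht
  refine ⟨by rw [hc t ht]; exact (hyV t ht).1, ?_⟩
  have : velocity I (TotalSpace.proj ∘ y) =ᶠ[𝓝 t] y := by
    filter_upwards [isOpen_Ioo.mem_nhds ht] with s hs using hc s hs
  rw [velocity_congr this, hc t ht]
  exact (hyV t ht).2

/-- The element of Δ given by J depends only on c'(0), α and β, since the coefficient α + βt equals
α at t = 0. Conversely these data can be prescribed, because a geodesic exists with any nonzero
initial velocity. -/
theorem parallelJacobiSet_eq [CompleteSpace E] (hS : IsSpray I S) :
    parallelJacobiSet I S = linearization (fieldMap I S) '' sprayLiouvilleSpan I S := by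
  ext ξ
  constructor
  · rintro ⟨ε, Y, hε, ⟨α, β, c, hc, hY⟩, rfl⟩
    have h0 : (0 : ℝ) ∈ Ioo (-ε) ε := by simpa using hε
    exact ⟨_, ⟨_, (hc.2 0 h0).1, _, _, rfl⟩,
      (velocity_canonicalInvolution_velocity_jacobi hS isOpen_Ioo hc hY h0).2.symm⟩
  · rintro ⟨_, ⟨y, hy, α, β, rfl⟩, rfl⟩
    obtain ⟨ε, c, hε, hc, rfl⟩ := exists_geodesic hS hy
    have h0 : (0 : ℝ) ∈ Ioo (-ε) ε := by simpa using hε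
    refine ⟨ε, fun t ↦ ⟨c t, α • (velocity I c t).2 + (β * t) • (velocity I c t).2⟩, hε,
      ⟨α, β, c, hc, fun t _ ↦ rfl⟩, ?_⟩
    rw [(velocity_canonicalInvolution_velocity_jacobi hS isOpen_Ioo hc
      (fun t _ ↦ rfl) h0).2, mul_zero, add_zero]

theorem tangentMap_projTT (ξ : TTT I M) : tangentMap I.tangent.tangent I (projTT I M) ξ =
    tangentMap I.tangent I TotalSpace.proj (tangentMap I.tangent.tangent I.tangent
      TotalSpace.proj ξ) :=
  tangentMap_comp_apply ξ (mdifferentiableAt_tangent_proj _) (mdifferentiableAt_tangent_proj _)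

theorem mem_slashed_projTT {ξ : TTT I M} : ξ ∈ slashed I I.tangent.tangent (projTT I M) ↔
    tangentMap I.tangent I TotalSpace.proj (tangentMap I.tangent.tangent I.tangent
      TotalSpace.proj ξ) ∈ slashed I I (id : M → M) := by
  rw [mem_slashed_iff, tangentMap_projTT]

theorem tangentMap_proj_linearization (q : TT I M) :
    tangentMap I.tangent.tangent I.tangent TotalSpace.proj (linearization (fieldMap I S) q) =
      fieldMap I S q.1 := by
  rw [linearization, tangentMap_proj_canonicalInvolution]
  rfl

theorem tangentMap_tangentMap_proj_linearization (hS : IsSpray I S) {q : TT I M}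
    (hq : q.1 ∈ slashed I I (id : M → M)) :
    tangentMap I.tangent I TotalSpace.proj (tangentMap I.tangent.tangent I.tangent
      TotalSpace.proj (linearization (fieldMap I S) q)) = q.1 := by
  rw [tangentMap_proj_linearization, hS.projection _ hq]

theorem parallelJacobiSet_subset_slashed [CompleteSpace E] (hS : IsSpray I S) :
    parallelJacobiSet I S ⊆ slashed I I.tangent.tangent (projTT I M) := by
  rw [parallelJacobiSet_eq hS]
  rintro _ ⟨_, ⟨y, hy, α, β, rfl⟩, rfl⟩
  rw [mem_slashed_projTT, tangentMap_tangentMap_proj_linearization hS hy]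
  exact hy

/-- `κ ∘ S = S`, since `Dπ ∘ S = id`. -/
theorem canonicalInvolution_fieldMap (hS : IsSpray I S) {y : TangentBundle I M}
    (hy : y ∈ slashed I I (id : M → M)) :
    canonicalInvolution I (fieldMap I S y) = fieldMap I S y := by
  have h := hS.projection y hy
  rw [tangentMap_proj] at h
  obtain ⟨x, v⟩ := y
  have hv : Prod.fst (α := E) (β := E) (S ⟨x, v⟩) = v := mk_tangent_injective (E := E) (I := I) h
  obtain ⟨w, hw⟩ : ∃ w : E × E, S ⟨x, v⟩ = w := ⟨_, rfl⟩
  rw [hw] at hv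
  have h1 : fieldMap I S ⟨x, v⟩ = (⟨⟨x, v⟩, w⟩ : TT I M) := congrArg (TotalSpace.mk _) hw
  rw [h1]
  subst hv
  rfl

/-- In coordinates κ exchanges the entries S(y) and v of DS(v), and these agree when v = S(y). -/
theorem linearization_fieldMap_fieldMap (hS : IsSpray I S) {y : TangentBundle I M}
    (hy : y ∈ slashed I I (id : M → M)) :
    linearization (fieldMap I S) (fieldMap I S y) =
      tangentMap I.tangent I.tangent.tangent (fieldMap I S) (fieldMap I S y) :=
  (linearization_section (mdifferentiableAt_fieldMap hS hy) _).trans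
    (tangentMap_section (mdifferentiableAt_fieldMap hS hy) _).symm

/-- `S^c ∘ S = DS ∘ S`. -/
theorem completeLift_fieldMap (hS : IsSpray I S) {y : TangentBundle I M}
    (hy : y ∈ slashed I I (id : M → M)) :
    completeLift I (fieldMap I S) (fieldMap I S y) =
      tangentMap I.tangent I.tangent.tangent (fieldMap I S) (fieldMap I S y) := by
  rw [completeLift_eq, canonicalInvolution_fieldMap hS hy, linearization_fieldMap_fieldMap hS hy,
    ← tangentMap_comp_apply _ (mdifferentiableAt_canonicalInvolution _)
      (mdifferentiableAt_fieldMap hS hy)]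
  apply tangentMap_congr
  filter_upwards [isOpen_slashed_id.mem_nhds hy] with z hz
  exact canonicalInvolution_fieldMap hS hz

theorem contMDiffOn_linearization_fieldMap (hS : IsSpray I S) :
    ContMDiffOn I.tangent.tangent I.tangent.tangent.tangent ∞ (linearization (fieldMap I S))
      (TotalSpace.proj ⁻¹' slashed I I (id : M → M)) :=
  contMDiffOn_linearization isOpen_slashed_id hS.smooth

theorem isOpen_proj_preimage_slashed :
    IsOpen (TotalSpace.proj ⁻¹' slashed I I (id : M → M) : Set (TT I M)) :=
  isOpen_proj_preimage isOpen_slashed_id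

theorem isOpen_tangentMap_proj_preimage {s : Set (TangentBundle I M)} (hs : IsOpen s) :
    IsOpen (tangentMap I.tangent I (TotalSpace.proj : TangentBundle I M → M) ⁻¹' s) :=
  hs.preimage (contMDiff_tangentMap contMDiff_tangent_proj).continuous

theorem contMDiffOn_completeLift_fieldMap (hS : IsSpray I S) :
    ContMDiffOn I.tangent.tangent I.tangent.tangent.tangent ∞ (completeLift I (fieldMap I S))
      (tangentMap I.tangent I TotalSpace.proj ⁻¹' slashed I I (id : M → M)) :=
  contMDiffOn_completeLift isOpen_slashed_id hS.smooth

/-- With L = κ ∘ DS one has κ(L(q)) = DS(q), so S^cc(L(q)) = Dκ(κ(D(S^c ∘ S)(q))). Replacing S^c ∘ S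
by DS ∘ S gives Dκ(κ(DDS(DS(q)))). Naturality moves κ inside DDS, and the result is D(κ ∘
DS)(κ(DS(q))) = DL(L(q)). -/
theorem tangentMap_linearization_eq_secondCompleteLift (hS : IsSpray I S) {q : TT I M}
    (hq : q.1 ∈ slashed I I (id : M → M)) :
    tangentMap I.tangent.tangent I.tangent.tangent.tangent (linearization (fieldMap I S))
      (linearization (fieldMap I S) q) =
      secondCompleteLift I S (linearization (fieldMap I S) q) := by
  have hO := isOpen_proj_preimage_slashed (I := I) (M := M)
  have hTS := contMDiffOn_tangentMap isOpen_slashed_id hS.smooth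
  have hTSat : ∀ r : TT I M, r.1 ∈ slashed I I (id : M → M) → MDifferentiableAt I.tangent.tangent
      I.tangent.tangent.tangent (tangentMap I.tangent I.tangent.tangent (fieldMap I S)) r :=
    fun r hr ↦ (hTS.contMDiffAt (hO.mem_nhds hr)).mdifferentiableAt (by simp)
  have hScat : MDifferentiableAt I.tangent.tangent I.tangent.tangent.tangent
      (completeLift I (fieldMap I S)) (fieldMap I S q.1) := by
    refine ((contMDiffOn_completeLift_fieldMap hS).contMDiffAt
      ((isOpen_tangentMap_proj_preimage isOpen_slashed_id).mem_nhds ?_)).mdifferentiableAt (by simp)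
    rw [mem_preimage, hS.projection _ hq]
    exact hq
  have hlin : (linearization (fieldMap I S) q).1 = q :=
    proj_linearization isOpen_slashed_id hS.smooth (fun _ _ ↦ rfl) q hq
  have e1 : tangentMap I.tangent.tangent I.tangent.tangent.tangent
      (completeLift I (fieldMap I S)) (tangentMap I.tangent I.tangent.tangent (fieldMap I S) q) =
      tangentMap I.tangent.tangent I.tangent.tangent.tangent
        (tangentMap I.tangent I.tangent.tangent (fieldMap I S))
        (tangentMap I.tangent I.tangent.tangent (fieldMap I S) q) := by
    rw [← tangentMap_comp_apply q hScat (mdifferentiableAt_fieldMap hS hq),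
      ← tangentMap_comp_apply q (hTSat _ hq) (mdifferentiableAt_fieldMap hS hq)]
    apply tangentMap_congr
    filter_upwards [isOpen_slashed_id.mem_nhds hq] with z hz
    exact completeLift_fieldMap hS hz
  have e2 : secondCompleteLift I S (linearization (fieldMap I S) q) =
      tangentMap I.tangent.tangent.tangent I.tangent.tangent.tangent
        (canonicalInvolution I.tangent) (canonicalInvolution I.tangent.tangent
          (tangentMap I.tangent.tangent I.tangent.tangent.tangent (completeLift I (fieldMap I S))
            (tangentMap I.tangent I.tangent.tangent (fieldMap I S) q))) := rfl
  have e3 : canonicalInvolution I.tangent (tangentMap I.tangent I.tangent.tangent (fieldMap I S) q) =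
    linearization (fieldMap I S) q := rfl
  rw [e2, e1, canonicalInvolution_tangentMap isOpen_slashed_id hS.smooth _ hq, e3,
    ← tangentMap_comp_apply _ (mdifferentiableAt_canonicalInvolution _)
      (hTSat _ (by rw [hlin]; exact hq))]
  rfl

theorem isGeodesicallyInvariant_parallelJacobiSet [CompleteSpace E] [T2Space M]
    (hS : IsSpray I S) :
    IsGeodesicallyInvariant I I.tangent.tangent (projTT I M) (secondCompleteLift I S)
      (parallelJacobiSet I S) := by
  rw [parallelJacobiSet_eq hS]
  rintro γ K hK hKc ⟨hγ, hgeo⟩ t₀ ht₀ ⟨_, ⟨y₀, hy₀, α, β, rfl⟩, hγ₀⟩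
  have : T2Space (TangentBundle I M) := t2Space_tangentBundle
  have : T2Space (TT I M) := t2Space_tangentBundle
  have : T2Space (TTT I M) := t2Space_tangentBundle
  set ζ := velocity I.tangent.tangent γ with hζdef
  have hζ : ContMDiffOn 𝓘(ℝ, ℝ) I.tangent.tangent.tangent ∞ ζ K := contMDiffOn_velocity hK hγ
  -- This is the velocity of the projection of γ to M. Defining y from γ itself, rather than solving
  -- an equation, makes it available on all of K.
  set y : ℝ → TangentBundle I M := fun t ↦ tangentMap I.tangent I TotalSpace.proj
    (tangentMap I.tangent.tangent I.tangent TotalSpace.proj (ζ t)) with hydef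
  have hT1 : ContMDiff I.tangent.tangent.tangent I.tangent.tangent ∞
      (tangentMap I.tangent.tangent I.tangent (TotalSpace.proj : TT I M → TangentBundle I M)) :=
    contMDiff_tangentMap contMDiff_tangent_proj
  have hT2 : ContMDiff I.tangent.tangent I.tangent ∞
      (tangentMap I.tangent I (TotalSpace.proj : TangentBundle I M → M)) :=
    contMDiff_tangentMap contMDiff_tangent_proj
  have hys : ContMDiffOn 𝓘(ℝ, ℝ) I.tangent ∞ y K := hT2.comp_contMDiffOn (hT1.comp_contMDiffOn hζ)
  have hmem : ∀ t ∈ K, y t ∈ slashed I I (id : M → M) := fun t ht ↦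
    mem_slashed_projTT.1 (hgeo t ht).1
  have hζmd : ∀ t ∈ K, MDifferentiableAt 𝓘(ℝ, ℝ) I.tangent.tangent.tangent ζ t := fun t ht ↦
    (hζ.contMDiffAt (hK.mem_nhds ht)).mdifferentiableAt (by simp)
  -- A complete lift projects to the original field under D(Dπ); applying this twice takes S^cc down
  -- to S.
  have hyS : ∀ t ∈ K, velocity I.tangent y t = fieldMap I S (y t) := by
    intro t ht
    have h1 : MDifferentiableAt 𝓘(ℝ, ℝ) I.tangent.tangent
        (tangentMap I.tangent.tangent I.tangent TotalSpace.proj ∘ ζ) t :=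
      ((hT1 (ζ t)).mdifferentiableAt (by simp)).comp t (hζmd t ht)
    have h2 : velocity I.tangent y t = tangentMap I.tangent.tangent I.tangent
        (tangentMap I.tangent I TotalSpace.proj) (velocity I.tangent.tangent
          (tangentMap I.tangent.tangent I.tangent TotalSpace.proj ∘ ζ) t) :=
      (tangentMap_velocity ((hT2 _).mdifferentiableAt (by simp)) h1).symm
    rw [h2, ← tangentMap_velocity ((hT1 _).mdifferentiableAt (by simp)) (hζmd t ht),
      (hgeo t ht).2, secondCompleteLift, tangentMap_tangentMap_proj_completeLift,
      tangentMap_tangentMap_proj_completeLift]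
  have hy0 : y t₀ = y₀ := by
    simp only [hydef]
    rw [← hγ₀, tangentMap_tangentMap_proj_linearization hS hy₀]
  -- The shift by t₀ gives a(t₀) = α, so that L ∘ Z starts at γ'(t₀).
  set a : ℝ → ℝ := fun t ↦ α + β * (t - t₀) with hadef
  have ha : ∀ t, HasDerivAt a β t := fun t ↦ by
    rw [hadef]
    simpa using (((hasDerivAt_id t).sub_const t₀).const_mul β).const_add α
  have has : ContDiff ℝ ∞ a := by fun_prop
  set Z : ℝ → TT I M := fun t ↦ ⟨y t, a t • S (y t) + β • liouville I (y t)⟩ with hZdef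
  have hZs : ContMDiffOn 𝓘(ℝ, ℝ) I.tangent.tangent ∞ Z K := fun t ht ↦
    (contMDiffAt_span_curve hS (hys.contMDiffAt (hK.mem_nhds ht)) has.contDiffAt
      (hmem t ht)).contMDiffWithinAt
  have hZmd : ∀ t ∈ K, MDifferentiableAt 𝓘(ℝ, ℝ) I.tangent.tangent Z t := fun t ht ↦
    (hZs.contMDiffAt (hK.mem_nhds ht)).mdifferentiableAt (by simp)
  set η : ℝ → TTT I M := fun t ↦ linearization (fieldMap I S) (Z t) with hηdef
  have hZη : ∀ t ∈ K, velocity I.tangent.tangent Z t = η t := fun t ht ↦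
    velocity_span_curve hS ((hys.contMDiffAt (hK.mem_nhds ht)).mdifferentiableAt (by simp)) (ha t)
      (hmem t ht) (hyS t ht)
  have hlin := contMDiffOn_linearization_fieldMap hS
  have hηs : ContMDiffOn 𝓘(ℝ, ℝ) I.tangent.tangent.tangent ∞ η K :=
    hlin.comp hZs fun t ht ↦ hmem t ht
  have hηS : ∀ t ∈ K, velocity I.tangent.tangent.tangent η t = secondCompleteLift I S (η t) := by
    intro t ht
    have h1 : velocity I.tangent.tangent.tangent η t = tangentMap I.tangent.tangent
        I.tangent.tangent.tangent (linearization (fieldMap I S))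
        (velocity I.tangent.tangent Z t) :=
      (tangentMap_velocity ((hlin.contMDiffAt
        (isOpen_proj_preimage_slashed.mem_nhds (hmem t ht))).mdifferentiableAt (by simp))
        (hZmd t ht)).symm
    rw [h1, hZη t ht]
    exact tangentMap_linearization_eq_secondCompleteLift hS (hmem t ht)
  set s₁ : Set (TT I M) :=
    tangentMap I.tangent I TotalSpace.proj ⁻¹' slashed I I (id : M → M) with hs₁
  have hs₁o : IsOpen s₁ := isOpen_tangentMap_proj_preimage isOpen_slashed_id
  set s₂ : Set (TTT I M) := tangentMap I.tangent.tangent I.tangent TotalSpace.proj ⁻¹' s₁ with hs₂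
  have hs₂o : IsOpen s₂ := isOpen_tangentMap_proj_preimage hs₁o
  have hSc := contMDiffOn_completeLift_fieldMap hS
  have hScs : ∀ q ∈ s₁, (completeLift I (fieldMap I S) q).1 = q := fun q hq ↦
    proj_completeLift isOpen_slashed_id hS.smooth (fun _ _ ↦ rfl) q hq
  have hScc := contMDiffOn_completeLift hs₁o hSc
  have hSccs : ∀ ξ ∈ s₂, (secondCompleteLift I S ξ).1 = ξ := fun ξ hξ ↦
    proj_completeLift hs₁o hSc hScs ξ hξ
  -- The map S^cc is a section only over the open set s₂. The uniqueness theorem takes a dependent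
  -- vector field, so the fibre part is extracted and agrees with S^cc on s₂.
  set V : ∀ ξ : TTT I M, TangentSpace I.tangent.tangent.tangent ξ :=
    fun ξ ↦ (secondCompleteLift I S ξ).2 with hV
  have hVeq : ∀ ξ ∈ s₂, (⟨ξ, V ξ⟩ : TangentBundle I.tangent.tangent.tangent (TTT I M)) =
      secondCompleteLift I S ξ := fun ξ hξ ↦ mk_eq_of_proj_eq (hSccs ξ hξ) _ rfl
  have hVs : ContMDiffOn I.tangent.tangent.tangent I.tangent.tangent.tangent.tangent ∞
      (fun ξ ↦ (⟨ξ, V ξ⟩ : TangentBundle I.tangent.tangent.tangent (TTT I M))) s₂ :=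
    hScc.congr hVeq
  have hηmem : ∀ t ∈ K, η t ∈ s₂ := fun t ht ↦ by
    simp only [hs₂, hs₁, mem_preimage, hηdef]
    rw [tangentMap_tangentMap_proj_linearization hS (hmem t ht)]
    exact hmem t ht
  have hEq : EqOn ζ η K := by
    refine eqOn_of_velocity_eq hs₂o hVs hK hKc hζmd
      (fun t ht ↦ (hηs.contMDiffAt (hK.mem_nhds ht)).mdifferentiableAt (by simp))
      (fun t ht ↦ ?_) (fun t ht ↦ ?_) (fun t ht ↦ hmem t ht) ht₀ ?_
    · rw [(hgeo t ht).2, hVeq _ (hmem t ht)]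
    · rw [hηS t ht, hVeq _ (hηmem t ht)]
    · rw [← hγ₀]
      simp only [hηdef, hZdef, hadef]
      rw [hy0, sub_self, mul_zero, add_zero]
  intro t ht
  rw [hEq ht]
  exact ⟨Z t, ⟨y t, hmem t ht, a t, β, rfl⟩, rfl⟩

end SprayFacts

/-! ### Parametrised subsets and their images under sections. -/

section Parametrizations

variable {E : Type*} [NormedAddCommGroup E] [NormedSpace ℝ E] [FiniteDimensional ℝ E]
  {H : Type*} [TopologicalSpace H] {I : ModelWithCorners ℝ E H} [I.Boundaryless]
  {N : Type*} [TopologicalSpace N] [ChartedSpace H N] [IsManifold I ∞ N]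
  {A : Type*} [NormedAddCommGroup A] [NormedSpace ℝ A] [FiniteDimensional ℝ A]

variable (I A) in
/-- Near `p`, the set `B` is the image of an open subset of `A` under a smooth map with a left
inverse that is differentiable at `p`. -/
def ParametrizableAt (B : Set N) (p : N) : Prop :=
  ∃ (F : A → N) (ρ : N → A) (O : Set A), IsOpen O ∧ ρ p ∈ O ∧ ContMDiffOn 𝓘(ℝ, A) I ∞ F O ∧
    MDifferentiableAt I 𝓘(ℝ, A) ρ p ∧ (∀ a ∈ O, F a ∈ B ∧ ρ (F a) = a) ∧
    ∀ᶠ q in 𝓝 p, q ∈ B → F (ρ q) = q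

theorem isSubmanifold_of_parametrizableAt {B : Set N} {d : ℕ} (hd : Module.finrank ℝ A = d)
    (hB : ∀ p ∈ B, ParametrizableAt I A B p) : IsSubmanifold I d B := by
  intro p hp
  obtain ⟨F, ρ, O, hO, hpO, hF, hρ, hFB, hBF⟩ := hB p hp
  exact hd ▸ exists_slice_chart hO hpO hF hρ hFB hBF hp

theorem parametrizableAt_of_isOpen {U : Set N} (hU : IsOpen U) {p : N} (hp : p ∈ U) :
    ParametrizableAt I E U p := by
  refine ⟨(extChartAt I p).symm, extChartAt I p,
    (extChartAt I p).target ∩ (extChartAt I p).symm ⁻¹' U,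
    (continuousOn_extChartAt_symm p).isOpen_inter_preimage (isOpen_extChartAt_target p) hU,
    ⟨mem_extChartAt_target p, by rwa [mem_preimage, extChartAt_to_inv]⟩,
    (contMDiffOn_extChartAt_symm p).mono inter_subset_left,
    mdifferentiableAt_extChartAt (mem_chart_source H p),
    fun a ha ↦ ⟨ha.2, (extChartAt I p).right_inv ha.1⟩, ?_⟩
  filter_upwards [extChartAt_source_mem_nhds (I := I) p] with q hq _
  exact (extChartAt I p).left_inv hq

/-- The bundle projection inverts a section, so a parametrisation F with left inverse ρ lifts to σ ∘
F with left inverse ρ ∘ π. This carries Σ to Δ and TM∖0 to S(TM∖0). -/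
theorem ParametrizableAt.image_section {B U : Set N} {p : N} (hB : ParametrizableAt I A B p)
    (hBU : B ⊆ U) {σ : N → TangentBundle I N} (hσ : ContMDiffOn I I.tangent ∞ σ U)
    (hsec : ∀ x ∈ U, (σ x).1 = x) (hp : p ∈ B) : ParametrizableAt I.tangent A (σ '' B) (σ p) := by
  obtain ⟨F, ρ, O, hO, hpO, hF, hρ, hFB, hBF⟩ := hB
  have hσp : (σ p).1 = p := hsec p (hBU hp)
  refine ⟨σ ∘ F, ρ ∘ TotalSpace.proj, O, hO, ?_, hσ.comp hF fun a ha ↦ hBU (hFB a ha).1, ?_,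
    fun a ha ↦ ⟨mem_image_of_mem σ (hFB a ha).1, ?_⟩, ?_⟩
  · simpa only [Function.comp_apply, hσp] using hpO
  · exact MDifferentiableAt.comp_of_eq (σ p) hρ (mdifferentiableAt_tangent_proj _) hσp
  · simp only [Function.comp_apply]
    rw [hsec _ (hBU (hFB a ha).1), (hFB a ha).2]
  · have h1 : ∀ᶠ q in 𝓝 (σ p), q.1 ∈ B → F (ρ q.1) = q.1 :=
      (FiberBundle.continuous_proj E (TangentSpace I)).continuousAt.eventually
        (by rw [hσp]; exact hBF)
    filter_upwards [h1] with q hq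
    rintro ⟨b, hb, rfl⟩
    simp only [Function.comp_apply]
    rw [hsec b (hBU hb)] at hq ⊢
    rw [hq hb]

end Parametrizations

/-! ### Submanifold, diffeomorphism and semi-distribution properties of Δ. -/

section SprayParametrizations

variable {E : Type*} [NormedAddCommGroup E] [NormedSpace ℝ E] [FiniteDimensional ℝ E]
  {H : Type*} [TopologicalSpace H] {I : ModelWithCorners ℝ E H} [I.Boundaryless]
  {M : Type*} [TopologicalSpace M] [ChartedSpace H M] [IsManifold I ∞ M]
  {S : ∀ y : TangentBundle I M, TangentSpace I.tangent y}

theorem sprayLiouvilleSpan_subset :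
    sprayLiouvilleSpan I S ⊆ TotalSpace.proj ⁻¹' slashed I I (id : M → M) := by
  rintro _ ⟨y, hy, α, β, rfl⟩
  exact hy

/-- In a chart S = (v, g) by Dπ ∘ S = id, and E = (0, v), where v is the fibre coordinate of y. -/
theorem trivializationAt_span (hS : IsSpray I S) {p y : TangentBundle I M}
    (hyp : y.1 ∈ (chartAt H p.1).source) (hy : y ∈ slashed I I (id : M → M)) (α β : ℝ) :
    (trivializationAt (E × E) (TangentSpace I.tangent) p
      (⟨y, α • S y + β • liouville I y⟩ : TT I M)).2 =
      (α • (trivializationAt E (TangentSpace I) p.1 y).2,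
        α • (trivializationAt (E × E) (TangentSpace I.tangent) p (fieldMap I S y)).2.2 +
          β • (trivializationAt E (TangentSpace I) p.1 y).2) := by
  have hyp' : y ∈ (chartAt (ModelProd H E) p).source := by simpa using hyp
  rw [trivializationAt_smul_add_smul hyp', trivializationAt_liouville p y hyp]
  have h1 := fst_trivializationAt_tangent p (fieldMap I S y) hyp
  rw [hS.projection y hy] at h1
  refine Prod.ext ?_ rfl
  change α • Prod.fst (α := E) (β := E) (trivializationAt (E × E) (TangentSpace I.tangent) p
    (fieldMap I S y)).2 + β • (0 : E) = _
  rw [h1, smul_zero, add_zero]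

/-- The parameters are y in a chart together with α and β. In coordinates αS + βE = (αv, αg + βv),
so α and β can be recovered with a linear functional that does not vanish on v. -/
theorem parametrizableAt_sprayLiouvilleSpan (hS : IsSpray I S) {q₀ : TT I M}
    (hq₀ : q₀ ∈ sprayLiouvilleSpan I S) :
    ParametrizableAt I.tangent.tangent ((E × E) × (ℝ × ℝ)) (sprayLiouvilleSpan I S) q₀ := by
  obtain ⟨p, hp, α₀, β₀, rfl⟩ := hq₀
  set v₀ : E := (extChartAt I.tangent p p).2 with hv₀
  have hv₀ne : v₀ ≠ 0 := by
    have h : v₀ = p.2 := trivializationAt_self p.1 p.2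
    rw [h]
    exact mem_slashed_id.1 hp
  obtain ⟨l, hl⟩ : ∃ l : E →L[ℝ] ℝ, l v₀ ≠ 0 := SeparatingDual.exists_ne_zero hv₀ne
  set g : TangentBundle I M → E × E := fun y ↦
    (trivializationAt (E × E) (TangentSpace I.tangent) p (fieldMap I S y)).2 with hg
  set w : TT I M → E × E := fun q ↦
    (trivializationAt (E × E) (TangentSpace I.tangent) p q).2 with hw
  -- The three entries are the coordinates of y, the fibre coordinates w of q and the fibre
  -- coordinates g of S(y). Thus α = l(w₁)/l(v) and β = (l(w₂) − α l(g₂))/l(v).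
  set R : (E × E) × (E × E) × (E × E) → (E × E) × (ℝ × ℝ) := fun x ↦
    (x.1, (l x.2.1.1 / l x.1.2,
      (l x.2.1.2 - l x.2.1.1 / l x.1.2 * l x.2.2.2) / l x.1.2)) with hR
  set φ := extChartAt I.tangent p with hφ
  set Q : TT I M → (E × E) × (E × E) × (E × E) := fun q ↦ (φ q.1, w q, g q.1) with hQ
  have hφs : φ.source = TotalSpace.proj ⁻¹' (chartAt H p.1).source := by
    rw [hφ, extChartAt_source]
    ext y
    simp
  set U : Set (TangentBundle I M) := {y | y ∈ φ.source ∧ y ∈ slashed I I (id : M → M) ∧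
    l (φ y).2 ≠ 0} with hU
  have hUo : IsOpen U := by
    have h1 : IsOpen (φ.source ∩ φ ⁻¹' {z : E × E | l z.2 ≠ 0}) :=
      (continuousOn_extChartAt p).isOpen_inter_preimage (isOpen_extChartAt_source p)
        (isOpen_ne.preimage (l.continuous.comp continuous_snd))
    have h2 := h1.inter (isOpen_slashed_id (I := I) (M := M))
    have h3 : U = φ.source ∩ φ ⁻¹' {z : E × E | l z.2 ≠ 0} ∩ slashed I I (id : M → M) := by
      ext y
      simp only [hU, mem_inter_iff, mem_preimage]
      exact ⟨fun h ↦ ⟨⟨h.1, h.2.2⟩, h.2.1⟩, fun h ↦ ⟨h.1.1, h.2, h.1.2⟩⟩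
    rw [h3]
    exact h2
  have hpU : p ∈ U := ⟨mem_extChartAt_source p, hp, hl⟩
  set D : (E × E) × (ℝ × ℝ) → TT I M := fun a ↦
    ⟨φ.symm a.1, a.2.1 • S (φ.symm a.1) + a.2.2 • liouville I (φ.symm a.1)⟩ with hD
  have hRQ : ∀ y ∈ U, ∀ α β : ℝ, R (Q ⟨y, α • S y + β • liouville I y⟩) = (φ y, (α, β)) := by
    rintro y ⟨hyφ, hys, hly⟩ α β
    have hyc : y.1 ∈ (chartAt H p.1).source := by
      rw [hφs] at hyφ
      exact hyφ
    have hφ2 : (φ y).2 = (trivializationAt E (TangentSpace I) p.1 y).2 := rfl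
    simp only [hR, hQ, hw, hg]
    rw [trivializationAt_span hS hyc hys, ← hφ2]
    simp only [map_smul, map_add, smul_eq_mul]
    refine Prod.ext rfl (Prod.ext ?_ ?_)
    · field_simp
    · field_simp
      ring
  set O : Set ((E × E) × (ℝ × ℝ)) := Prod.fst ⁻¹' (φ.target ∩ φ.symm ⁻¹' U) with hO
  have hOo : IsOpen O := ((continuousOn_extChartAt_symm p).isOpen_inter_preimage
    (isOpen_extChartAt_target p) hUo).preimage continuous_fst
  have hinv : φ.symm (φ p) = p := extChartAt_to_inv p
  have hRp := hRQ p hpU α₀ β₀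
  refine ⟨D, R ∘ Q, O, hOo, ?_, ?_, ?_, ?_, ?_⟩
  · rw [Function.comp_apply, hRp]
    refine ⟨mem_extChartAt_target p, ?_⟩
    simp only [mem_preimage, hinv]
    exact hpU
  · intro a ha
    have hfst : ContMDiffAt 𝓘(ℝ, (E × E) × (ℝ × ℝ)) I.tangent ∞ (fun a ↦ φ.symm a.1) a :=
      ContMDiffAt.comp a ((contMDiffOn_extChartAt_symm p).contMDiffAt
        ((isOpen_extChartAt_target p).mem_nhds ha.1)) contDiff_fst.contMDiff.contMDiffAt
    have h1 : ContDiff ℝ ∞ (fun a : (E × E) × (ℝ × ℝ) ↦ a.2.1) := by fun_prop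
    have h2 : ContDiff ℝ ∞ (fun a : (E × E) × (ℝ × ℝ) ↦ a.2.2) := by fun_prop
    have h3 : ContMDiffAt 𝓘(ℝ, (E × E) × (ℝ × ℝ)) I.tangent.tangent ∞
        (fun b ↦ (⟨φ.symm b.1, S (φ.symm b.1)⟩ : TT I M)) a :=
      ContMDiffAt.comp (I' := I.tangent) (g := fieldMap I S) a
        (hS.smooth.contMDiffAt (isOpen_slashed_id.mem_nhds ha.2.2.1)) hfst
    have h4 : ContMDiffAt 𝓘(ℝ, (E × E) × (ℝ × ℝ)) I.tangent.tangent ∞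
        (fun b ↦ (⟨φ.symm b.1, liouville I (φ.symm b.1)⟩ : TT I M)) a :=
      ContMDiffAt.comp (I' := I.tangent) (g := fun y ↦ (⟨y, liouville I y⟩ : TT I M))
        (f := fun b : (E × E) × (ℝ × ℝ) ↦ φ.symm b.1) a (contMDiff_liouville _) hfst
    exact (contMDiffAt_smul_add_smul (I := I.tangent) h3 h4 h1.contMDiff.contMDiffAt
      h2.contMDiff.contMDiffAt).contMDiffWithinAt
  · set q₀ : TT I M := ⟨p, α₀ • S p + β₀ • liouville I p⟩ with hq₀
    have hQd : ContMDiffAt I.tangent.tangent 𝓘(ℝ, (E × E) × (E × E) × (E × E)) ∞ Q q₀ := by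
      have hπ := contMDiff_tangent_proj (I := I.tangent) (N := TangentBundle I M) q₀
      have h1 : ContMDiffAt I.tangent.tangent 𝓘(ℝ, E × E) ∞ (fun q : TT I M ↦ φ q.1) q₀ :=
        ContMDiffAt.comp q₀ (contMDiffAt_extChartAt (n := ∞) (I := I.tangent) (x := p)) hπ
      have h2 : ContMDiffAt I.tangent.tangent 𝓘(ℝ, E × E) ∞ w q₀ :=
        (contMDiffAt_totalSpace.1 (contMDiffAt_id (n := ∞) (I := I.tangent.tangent) (x := q₀))).2
      have h3 : ContMDiffAt I.tangent 𝓘(ℝ, E × E) ∞ g p :=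
        (contMDiffAt_totalSpace.1 (hS.smooth.contMDiffAt (isOpen_slashed_id.mem_nhds hp))).2
      exact h1.prodMk_space (h2.prodMk_space (ContMDiffAt.comp (I' := I.tangent) (g := g) q₀ h3 hπ))
    have hRd : DifferentiableAt ℝ R (Q q₀) := by
      have hdiv : ∀ f : (E × E) × (E × E) × (E × E) → ℝ, DifferentiableAt ℝ f (Q q₀) →
          DifferentiableAt ℝ (fun x ↦ f x / l x.1.2) (Q q₀) := by
        intro f hf
        have hl' : DifferentiableAt ℝ (fun x : (E × E) × (E × E) × (E × E) ↦ l x.1.2) (Q q₀) := by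
          fun_prop
        simp only [div_eq_mul_inv]
        exact hf.mul (hl'.inv hl)
      have d2 : DifferentiableAt ℝ (fun x : (E × E) × (E × E) × (E × E) ↦ l x.2.1.1) (Q q₀) := by
        fun_prop
      have d3 : DifferentiableAt ℝ (fun x : (E × E) × (E × E) × (E × E) ↦ l x.2.1.2) (Q q₀) := by
        fun_prop
      have d4 : DifferentiableAt ℝ (fun x : (E × E) × (E × E) × (E × E) ↦ l x.2.2.2) (Q q₀) := by
        fun_prop
      exact differentiableAt_fst.prodMk ((hdiv _ d2).prodMk
        (hdiv _ (d3.sub ((hdiv _ d2).mul d4))))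
    exact hRd.mdifferentiableAt.comp q₀ (hQd.mdifferentiableAt (by simp))
  · intro a ha
    refine ⟨⟨φ.symm a.1, ha.2.2.1, a.2.1, a.2.2, rfl⟩, ?_⟩
    simp only [Function.comp_apply, hD]
    rw [hRQ _ ha.2, φ.right_inv ha.1]
  · have h1 : ∀ᶠ q : TT I M in 𝓝 ⟨p, α₀ • S p + β₀ • liouville I p⟩, q.1 ∈ U :=
      (isOpen_proj_preimage hUo).mem_nhds hpU
    filter_upwards [h1] with q hqU
    rintro ⟨y, hy, α, β, rfl⟩
    rw [Function.comp_apply, hRQ y hqU]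
    simp only [hD]
    rw [φ.left_inv hqU.1]

theorem finrank_span_model : Module.finrank ℝ ((E × E) × (ℝ × ℝ)) =
    2 * Module.finrank ℝ E + 2 := by
  simp only [Module.finrank_prod, Module.finrank_self]
  ring

theorem isSubmanifold_sprayLiouvilleSpan (hS : IsSpray I S) :
    IsSubmanifold I.tangent.tangent (2 * Module.finrank ℝ E + 2) (sprayLiouvilleSpan I S) :=
  isSubmanifold_of_parametrizableAt (A := (E × E) × (ℝ × ℝ)) finrank_span_model
    fun _ hq ↦ parametrizableAt_sprayLiouvilleSpan hS hq

theorem proj_linearization_fieldMap (hS : IsSpray I S) {q : TT I M}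
    (hq : q.1 ∈ slashed I I (id : M → M)) : (linearization (fieldMap I S) q).1 = q :=
  proj_linearization isOpen_slashed_id hS.smooth (fun _ _ ↦ rfl) q hq

theorem isSubmanifold_parallelJacobiSet (hS : IsSpray I S) :
    IsSubmanifold I.tangent.tangent.tangent (2 * Module.finrank ℝ E + 2)
      (parallelJacobiSet I S) := by
  have : CompleteSpace E := FiniteDimensional.complete ℝ E
  rw [parallelJacobiSet_eq hS]
  refine isSubmanifold_of_parametrizableAt (A := (E × E) × (ℝ × ℝ)) finrank_span_model ?_
  rintro _ ⟨q, hq, rfl⟩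
  exact (parametrizableAt_sprayLiouvilleSpan hS hq).image_section sprayLiouvilleSpan_subset
    (contMDiffOn_linearization_fieldMap hS) (fun _ hx ↦ proj_linearization_fieldMap hS hx) hq

theorem proj_image_parallelJacobiSet (hS : IsSpray I S) :
    TotalSpace.proj '' parallelJacobiSet I S = sprayLiouvilleSpan I S := by
  have : CompleteSpace E := FiniteDimensional.complete ℝ E
  rw [parallelJacobiSet_eq hS, image_image]
  exact (image_congr fun q hq ↦ proj_linearization_fieldMap hS
    (sprayLiouvilleSpan_subset hq)).trans (image_id' _)

/-- The bundle projection and the section L are inverse to each other between L(Σ) and Σ. -/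
theorem areDiffeomorphic_parallelJacobiSet (hS : IsSpray I S) :
    AreDiffeomorphic I.tangent.tangent.tangent I.tangent.tangent (parallelJacobiSet I S)
      (TotalSpace.proj '' parallelJacobiSet I S) := by
  have : CompleteSpace E := FiniteDimensional.complete ℝ E
  rw [proj_image_parallelJacobiSet hS, parallelJacobiSet_eq hS]
  have hinv : ∀ q ∈ sprayLiouvilleSpan I S, (linearization (fieldMap I S) q).1 = q := fun q hq ↦
    proj_linearization_fieldMap hS (sprayLiouvilleSpan_subset hq)
  refine ⟨TotalSpace.proj, linearization (fieldMap I S), contMDiff_tangent_proj.contMDiffOn,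
    (contMDiffOn_linearization_fieldMap hS).mono sprayLiouvilleSpan_subset, ?_,
    mapsTo_image _ _, ?_, hinv⟩
  · rintro _ ⟨q, hq, rfl⟩
    rwa [hinv q hq]
  · rintro _ ⟨q, hq, rfl⟩
    rw [hinv q hq]

theorem canonicalInvolution_image_parallelJacobiSet (hS : IsSpray I S) :
    canonicalInvolution I.tangent '' parallelJacobiSet I S =
      tangentMap I.tangent I.tangent.tangent (fieldMap I S) '' sprayLiouvilleSpan I S := by
  have : CompleteSpace E := FiniteDimensional.complete ℝ E
  rw [parallelJacobiSet_eq hS, image_image]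
  rfl

theorem proj_image_canonicalInvolution_image (hS : IsSpray I S) :
    TotalSpace.proj '' (canonicalInvolution I.tangent '' parallelJacobiSet I S) =
      fieldMap I S '' slashed I I (id : M → M) := by
  rw [canonicalInvolution_image_parallelJacobiSet hS, image_image]
  ext u
  constructor
  · rintro ⟨_, ⟨y, hy, α, β, rfl⟩, rfl⟩
    exact ⟨y, hy, rfl⟩
  · rintro ⟨y, hy, rfl⟩
    -- The zero vector at y already suffices: its image under DS lies over S(y).
    exact ⟨_, ⟨y, hy, 0, 0, rfl⟩, rfl⟩

theorem isSubmanifold_fieldMap_image (hS : IsSpray I S) :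
    IsSubmanifold I.tangent.tangent (2 * Module.finrank ℝ E)
      (fieldMap I S '' slashed I I (id : M → M)) := by
  have hd : Module.finrank ℝ (E × E) = 2 * Module.finrank ℝ E := by
    rw [Module.finrank_prod]
    ring
  refine isSubmanifold_of_parametrizableAt hd ?_
  rintro _ ⟨y, hy, rfl⟩
  exact (parametrizableAt_of_isOpen isOpen_slashed_id hy).image_section Subset.rfl hS.smooth
    (fun _ _ ↦ rfl) hy

/-- In coordinates S = (v, ·) and E = (0, v) with v ≠ 0, a triangular pair. -/
theorem linearIndependent_spray_liouville (hS : IsSpray I S) {y : TangentBundle I M}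
    (hy : y ∈ slashed I I (id : M → M)) {a b : ℝ} (h : a • S y + b • liouville I y = 0) :
    a = 0 ∧ b = 0 := by
  have h1 := hS.projection y hy
  rw [tangentMap_proj] at h1
  obtain ⟨x, v⟩ := y
  have hv0 : v ≠ 0 := mem_slashed_id.1 hy
  have hv : Prod.fst (α := E) (β := E) (S ⟨x, v⟩) = v := mk_tangent_injective (E := E) (I := I) h1
  have h2 : a • Prod.fst (α := E) (β := E) (S ⟨x, v⟩) + b • (0 : E) = 0 :=
    congrArg (Prod.fst (α := E) (β := E)) h
  have h3 : a • Prod.snd (α := E) (β := E) (S ⟨x, v⟩) + b • (show E from v) = 0 :=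
    congrArg (Prod.snd (α := E) (β := E)) h
  rw [hv, smul_zero, add_zero] at h2
  have ha : a = 0 := (smul_eq_zero.1 h2).resolve_right hv0
  subst ha
  rw [zero_smul, zero_add] at h3
  exact ⟨rfl, (smul_eq_zero.1 h3).resolve_right hv0⟩

theorem isSemiDistribution_parallelJacobiSet (hS : IsSpray I S) :
    IsSemiDistribution I.tangent 2 (parallelJacobiSet I S) := by
  have hT := contMDiffOn_tangentMap isOpen_slashed_id hS.smooth
  refine ⟨one_le_two, ⟨2 * Module.finrank ℝ E + 2, ?_⟩, ⟨2 * Module.finrank ℝ E, ?_⟩, ?_⟩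
  · rw [proj_image_parallelJacobiSet hS]
    exact isSubmanifold_sprayLiouvilleSpan hS
  · rw [proj_image_canonicalInvolution_image hS]
    exact isSubmanifold_fieldMap_image hS
  · rw [proj_image_canonicalInvolution_image hS, canonicalInvolution_image_parallelJacobiSet hS]
    intro b hb
    -- The frame DS(S(y)), DS(E(y)) at u = S(y) is global on S(TM∖0); there y is recovered as the
    -- base point u.1.
    refine ⟨_, hb, ⟨univ, isOpen_univ, (inter_univ _).symm⟩,
      ![fun u ↦ mfderiv I.tangent I.tangent.tangent (fieldMap I S) u.1 (S u.1),
        fun u ↦ mfderiv I.tangent I.tangent.tangent (fieldMap I S) u.1 (liouville I u.1)], ?_, ?_⟩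
    · intro i
      have h0 : ∀ W : ∀ y : TangentBundle I M, TangentSpace I.tangent y,
          ContMDiffOn I.tangent I.tangent.tangent ∞ (fun y ↦ (⟨y, W y⟩ : TT I M))
            (slashed I I (id : M → M)) →
          ContMDiffOn I.tangent.tangent I.tangent.tangent.tangent ∞ (fun u : TT I M ↦
            (⟨u, (mfderiv I.tangent I.tangent.tangent (fieldMap I S) u.1 (W u.1) :
              (E × E) × (E × E))⟩ : TTT I M)) (fieldMap I S '' slashed I I (id : M → M)) := by
        intro W hW
        have h1 := hT.comp (hW.comp (contMDiff_tangent_proj (I := I.tangent)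
          (N := TangentBundle I M)).contMDiffOn (s := TotalSpace.proj ⁻¹' slashed I I (id : M → M))
          fun u hu ↦ hu) fun u hu ↦ hu
        have hsub : fieldMap I S '' slashed I I (id : M → M) ⊆
            TotalSpace.proj ⁻¹' slashed I I (id : M → M) := by
          rintro _ ⟨y, hy, rfl⟩
          exact hy
        refine (h1.mono hsub).congr ?_
        rintro _ ⟨y, hy, rfl⟩
        rfl
      fin_cases i
      · exact h0 S hS.smooth
      · exact h0 (liouville I) contMDiff_liouville.contMDiffOn
    · rintro _ ⟨y, hy, rfl⟩
      set L := mfderiv I.tangent I.tangent.tangent (fieldMap I S) y with hL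
      -- The derivative of a section is injective, with left inverse the derivative of the
      -- projection.
      have hinj : ∀ v, L v = 0 → v = 0 := by
        intro v hv
        have h1 : tangentMap I.tangent.tangent I.tangent TotalSpace.proj
            (tangentMap I.tangent I.tangent.tangent (fieldMap I S) ⟨y, v⟩) = ⟨y, v⟩ := by
          rw [← tangentMap_comp_apply _ (mdifferentiableAt_tangent_proj _)
            (mdifferentiableAt_fieldMap hS hy)]
          exact tangentMap_of_eventuallyEq_id (.of_forall fun _ ↦ rfl)
        have h2 : mfderiv I.tangent.tangent I.tangent
            (TotalSpace.proj : TT I M → TangentBundle I M) (fieldMap I S y) (L v) = v :=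
          mk_tangent_injective (E := E × E) (I := I.tangent) h1
        rw [← h2, hv, map_zero]
        rfl
      have hL2 : ∀ a b : ℝ, a • L (S y) + b • L (liouville I y) =
          L (a • S y + b • liouville I y) := fun a b ↦ by
        rw [map_add, map_smul, map_smul]
      have hrange : (fun i ↦ (![fun u ↦ mfderiv I.tangent I.tangent.tangent (fieldMap I S) u.1
          (S u.1), fun u ↦ mfderiv I.tangent I.tangent.tangent (fieldMap I S) u.1
          (liouville I u.1)] : Fin 2 → ∀ u : TT I M, TangentSpace I.tangent.tangent u) i
          (fieldMap I S y)) = ![L (S y), L (liouville I y)] := by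
        funext i
        fin_cases i <;> rfl
      rw [hrange]
      constructor
      · rw [LinearIndependent.pair_iff]
        intro a b hab
        exact linearIndependent_spray_liouville hS hy (hinj _ ((hL2 a b).symm.trans hab))
      · ext w
        rw [SetLike.mem_coe, Matrix.range_cons_cons_empty, Submodule.mem_span_pair]
        constructor
        · rintro ⟨_, ⟨y', hy', α, β, rfl⟩, h⟩
          have hyy : y' = y := congrArg (fun z : TTT I M ↦ z.1.1) h
          subst hyy
          exact ⟨α, β, (hL2 α β).trans
            (mk_tangent_injective (E := (E × E) × (E × E)) (I := I.tangent.tangent) h)⟩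
        · rintro ⟨α, β, rfl⟩
          exact ⟨_, ⟨y, hy, α, β, rfl⟩, congrArg (fun z ↦ (⟨fieldMap I S y, z⟩ : TTT I M))
            (hL2 α β).symm⟩

end SprayParametrizations

end SprayGeometry

/-! ### The proposition over the model ℝⁿ. -/

open SprayGeometry
theorem mainTheorem6 (n : ℕ) (hn : 1 ≤ n)
    (M : Type*) [TopologicalSpace M] [T2Space M] [SecondCountableTopology M]
    [ChartedSpace (EuclideanSpace ℝ (Fin n)) M] [IsManifold (𝓡 n) ∞ M]
    (S : ∀ y : TangentBundle (𝓡 n) M, TangentSpace (𝓡 n).tangent y)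
    (hS : IsSpray (𝓡 n) S) :
    -- `Δ` lies in the slashed bundle `TTTM∖0`
    parallelJacobiSet (𝓡 n) S ⊆ slashed (𝓡 n) (𝓡 n).tangent.tangent (projTT (𝓡 n) M) ∧
    -- `Δ` is a semi-distribution on `TTM` of rank `2`
    IsSemiDistribution (𝓡 n).tangent 2 (parallelJacobiSet (𝓡 n) S) ∧
    -- `Δ` is geodesically invariant for `S^cc`
    IsGeodesicallyInvariant (𝓡 n) (𝓡 n).tangent.tangent (projTT (𝓡 n) M)
      (secondCompleteLift (𝓡 n) S) (parallelJacobiSet (𝓡 n) S) ∧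
    -- `Δ` and `π₂(Δ)` are submanifolds of dimension `2n + 2`, and they are diffeomorphic
    IsSubmanifold (𝓡 n).tangent.tangent.tangent (2 * n + 2) (parallelJacobiSet (𝓡 n) S) ∧
    IsSubmanifold (𝓡 n).tangent.tangent (2 * n + 2)
      (Bundle.TotalSpace.proj '' parallelJacobiSet (𝓡 n) S) ∧
    AreDiffeomorphic (𝓡 n).tangent.tangent.tangent (𝓡 n).tangent.tangent
      (parallelJacobiSet (𝓡 n) S) (Bundle.TotalSpace.proj '' parallelJacobiSet (𝓡 n) S) := by
  have hd := finrank_euclideanSpace_fin (𝕜 := ℝ) (n := n)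
  refine ⟨parallelJacobiSet_subset_slashed hS, isSemiDistribution_parallelJacobiSet hS,
    isGeodesicallyInvariant_parallelJacobiSet hS, ?_, ?_, areDiffeomorphic_parallelJacobiSet hS⟩
  · have h := isSubmanifold_parallelJacobiSet hS
    rwa [hd] at h
  · rw [proj_image_parallelJacobiSet hS]
    have h := isSubmanifold_sprayLiouvilleSpan hS
    rwa [hd] at h
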